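/- Let $\Omega\subset\mathbb{R}^d$ be compact and convex, let $\mu,\nu$ be Borel probability measures on $\Omega$ with $\mu$ absolutely continuous with respect to Lebesgue measure, and let $\theta\in(0,1)$. Write $$W_1(\mu,\nu)=\min_{\gamma\in\Pi(\mu,\nu)}\int|x-y|\,d\gamma ,$$ where $\Pi(\mu,\nu)$ is the set of probability measures on $\Omega\times\Omega$ with marginals $\mu$ and $\nu$. A Kantorovich potential for $(\mu,\nu)$ is a maximizer of $\int u\,d\mu-\int u\,d\nu$ among the $1$-Lipschitz functions $u:\Omega\to\mathbb{R}$. Let $T_0$ be an optimal transport map for $(\mu,\nu)$, that is, a minimizer of $\int_\Omega|x-T(x)|\,d\mu$ among the measurable maps $T:\Omega\to\Omega$ with $T_\#\mu=\nu$, and let $$\ell_0(T_0)=\sup\{\ell\in\mathbb{R} : \mu(\{x\in\Omega : |x-T_0(x)|<\ell\})=0\}$$ be the essential infimum of $|x-T_0(x)|$ under $\mu$. TTC with adaptive step size defines measures $\mu_n$ iteratively: $\mu_0=\mu$ and $\mu_{n+1}=(f_n)_\#\mu_n$, where $u_n$ is any Kantorovich potential for $(\mu_n,\nu)$, $\eta_n=\theta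 W_1(\mu_n,\nu)$, and $f_n(x)=x-\eta_n\nabla u_n(x)$ where $\nabla u_n(x)$ exists, $f_n(x)=x$ elsewhere. Put $$N(\theta)=\Big\lceil \log_{1-\theta}\big(1-\ell_0(T_0)/W_1(\mu,\nu)\big)\Big\rceil-1\ \in\ \mathbb{Z}\cup\{\infty\},$$ with $N(\theta)=\infty$ if $\ell_0(T_0)=W_1(\mu,\nu)$. Then the iteration can be carried out up to every integer index $n$ with $0\le n\le N(\theta)$, and, whatever potentials are chosen, for every such $n$ the measure $\mu_n$ is a probability measure on $\Omega$ and $$W_1(\mu_n,\nu)=(1-\theta)^n\,W_1(\mu,\nu).$$ In particular, if $0<\ell_0(T_0)<W_1(\mu,\nu)$ (so that $0\le N(\theta)<\infty$), then $$W_1(\mu_{N(\theta)},\nu)\le\frac{W_1(\mu,\nu)-\ell_0(T_0)}{1-\theta}.$$ -/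

import Mathlib

open MeasureTheory
open scoped ENNReal

/-- The Euclidean space `ℝ^d`, with the Euclidean norm and Lebesgue measure `volume`. -/
abbrev Euc (d : ℕ) : Type := EuclideanSpace ℝ (Fin d)

/-- `μ ∈ 𝒫(Ω)`: a Borel probability measure on `ℝ^d` that is concentrated on `Ω`. -/
def IsProbOn {d : ℕ} (Ω : Set (Euc d)) (μ : Measure (Euc d)) : Prop :=
  IsProbabilityMeasure μ ∧ μ Ωᶜ = 0

/-- `T : Ω → Ω` is a transport map from `μ` to `ν`: it is (`μ`-almost everywhere) measurable and
`T_# μ = ν`.  Values of `T` outside `Ω` play no role, as `μ` is concentrated on `Ω`. -/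
def IsTransportMap {d : ℕ} (Ω : Set (Euc d)) (μ ν : Measure (Euc d)) (T : Euc d → Euc d) : Prop :=
  AEMeasurable T μ ∧ Set.MapsTo T Ω Ω ∧ μ.map T = ν

/-- The transport cost `∫ |x - T(x)| dμ`. -/
noncomputable def transportCost {d : ℕ} (μ : Measure (Euc d)) (T : Euc d → Euc d) : ℝ≥0∞ :=
  ∫⁻ x, ‖x - T x‖ₑ ∂μ

/-- `T` is an optimal transport map for `(μ, ν)`: a solution of
`min { ∫ |x - T(x)| dμ : T : Ω → Ω, T_# μ = ν }`. -/
def IsOptimalMap {d : ℕ} (Ω : Set (Euc d)) (μ ν : Measure (Euc d)) (T : Euc d → Euc d) : Prop :=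
  IsTransportMap Ω μ ν T ∧
    ∀ T' : Euc d → Euc d, IsTransportMap Ω μ ν T' → transportCost μ T ≤ transportCost μ T'

/-- The set `Π(μ, ν)` of admissible plans.  If the marginals belong to `𝒫(Ω)`, such a plan
automatically is a probability measure concentrated on `Ω × Ω`. -/
def transportPlans {d : ℕ} (μ ν : Measure (Euc d)) : Set (Measure (Euc d × Euc d)) :=
  {γ | γ.map Prod.fst = μ ∧ γ.map Prod.snd = ν}

/-- The Wasserstein-1 distance: the value of the Kantorovich problem
`min { ∫ |x - y| dγ : γ ∈ Π(μ, ν) }` (finite for measures in `𝒫(Ω)`, `Ω` compact). -/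
noncomputable def W1 {d : ℕ} (μ ν : Measure (Euc d)) : ℝ :=
  (⨅ γ ∈ transportPlans μ ν, ∫⁻ p, ‖p.1 - p.2‖ₑ ∂γ).toReal

/-- `u` is a Kantorovich potential for `(μ, ν)`: it maximizes `∫ u dμ - ∫ u dν` among the
1-Lipschitz functions on `Ω`.  Only the values of `u` on `Ω` matter. -/
def IsKantorovichPotential {d : ℕ} (Ω : Set (Euc d)) (μ ν : Measure (Euc d))
    (u : Euc d → ℝ) : Prop :=
  LipschitzOnWith 1 u Ω ∧
    ∀ v : Euc d → ℝ, LipschitzOnWith 1 v Ω →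
      (∫ x in Ω, v x ∂μ) - (∫ x in Ω, v x ∂ν) ≤ (∫ x in Ω, u x ∂μ) - (∫ x in Ω, u x ∂ν)

open Classical in
/-- The gradient descent map of a function `u` on `Ω` with step `η`: `x - η ∇u(x)` where `∇u(x)`
exists, and `x` elsewhere.  As `u` is a function on `Ω`, the gradient is taken relative to `Ω`; at
interior points of `Ω` this is the usual gradient. -/
noncomputable def gradStep {d : ℕ} (Ω : Set (Euc d)) (η : ℝ) (u : Euc d → ℝ) (x : Euc d) : Euc d :=
  if DifferentiableWithinAt ℝ u Ω x then x - η • gradientWithin u Ω x else x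

/-- `K` steps of TTC with adaptive step size `η_n = θ W₁(μ_n, ν)`, started at `μ`: `μ_0 = μ` and, for
`n < K`, `u_n` is some Kantorovich potential for `(μ_n, ν)` and `μ_{n+1} = (f_n)_# μ_n`, with `f_n`
the gradient descent map of `u_n` with step `η_n`. -/
def IsTTCRun {d : ℕ} (Ω : Set (Euc d)) (θ : ℝ) (μ ν : Measure (Euc d)) (K : ℕ)
    (μs : ℕ → Measure (Euc d)) (us : ℕ → Euc d → ℝ) : Prop :=
  μs 0 = μ ∧
    ∀ n < K, IsKantorovichPotential Ω (μs n) ν (us n) ∧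
      μs (n + 1) = (μs n).map (gradStep Ω (θ * W1 (μs n) ν) (us n))

/-- The minimal transport length `ℓ₀(T)`, i.e. the essential infimum of `|x - T(x)|` under `μ`:
`sup { ℓ ∈ ℝ : μ {x ∈ Ω : |x - T(x)| < ℓ} = 0 }`. -/
noncomputable def minLength {d : ℕ} (Ω : Set (Euc d)) (μ : Measure (Euc d))
    (T : Euc d → Euc d) : ℝ :=
  sSup {l : ℝ | μ {x ∈ Ω | ‖x - T x‖ < l} = 0}

/-- The number `N(θ) = ⌈log_{1-θ}(1 - ℓ/W)⌉ - 1 ∈ ℤ ∪ {∞}`.  For `ℓ = W` the logarithm in base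
`1 - θ < 1` is `log_{1-θ}(0) = ∞`, so that `N(θ) = ∞`. -/
noncomputable def horizon (θ l W : ℝ) : WithTop ℤ :=
  if l < W then ((⌈Real.logb (1 - θ) (1 - l / W)⌉ - 1 : ℤ) : WithTop ℤ) else ⊤

/-!
The iteration moves almost every point `x` straight towards `T₀ x`. Let `e x` be the unit vector from
`T₀ x` to `x` (`unitDir x (T₀ x)`), and `t n = W (1 - (1 - θ) ^ n)` with `W = W1 μ ν`. The claim is that
`μ_n` is the image of `μ` under `x ↦ x - t n • e x` for all `n` up to the horizon, which,
if `W > 0`, consists of the `n` for which `t n` is smaller than the minimal transport length. (If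
`W = 0`, no step moves anything.)

The link between `T₀` and potentials is a 1-Lipschitz function `u` with `u x - u (T₀ x) = |x - T₀ x|`
almost everywhere (`IsOptimalMap.exists_lipschitz_sub_eq_norm`). Optimality of `T₀` among *maps* gives
it in two steps: an atomless measure can realize any plan by a map up to a small error
(`exists_map_lintegral_le`), and strong duality holds on compact spaces
(`exists_coupling_integral_dist_le`, by Hahn–Banach and the Riesz–Markov–Kakutani theorem).

The function `u` has slope one on each segment `[x, T₀ x]`. It therefore certifies that the coupling
of `x - t • e x` with `T₀ x` is optimal, of cost `W - t`. It also forces *every* potential of the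
displaced measure and `ν` to have slope one along what is left of the segments
(`IsKantorovichPotential.slope`), so the gradient of such a potential, where it exists, is `e x`
(`gradient_eq_unitDir`). It exists almost everywhere by Rademacher's theorem, because the displaced
measure is still absolutely continuous (`map_sub_smul_unitDir_absolutelyContinuous`): points interior
to slope-one segments of `u`, with a fixed margin at both ends, have ray directions that depend on the
point in a Lipschitz way, so the displacement has a Lipschitz inverse. The next step thus has length
`θ (W - t n)` in the direction `-e x`, and `t n + θ (W - t n) = t (n + 1)`.
-/

/-! ### Kantorovich–Rubinstein duality on compact metric spaces -/

/-- If `φ x + ψ y ≤ s d(x, y)`, the `c`-transform `u x = inf_y (s d(x, y) - ψ y)` is an `s`-Lipschitz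
function between `φ` and `-ψ`. -/
theorem exists_lipschitz_between {X : Type*} [MetricSpace X] [CompactSpace X] {φ ψ : C(X, ℝ)}
    {s : NNReal} (h : ∀ x y, φ x + ψ y ≤ s * dist x y) :
    ∃ u : X → ℝ, LipschitzWith s u ∧ ∀ x, φ x ≤ u x ∧ u x ≤ -ψ x := by
  rcases isEmpty_or_nonempty X with hX | hX
  · exact ⟨fun _ => 0, LipschitzWith.of_dist_le_mul fun x => (hX.false x).elim,
      fun x => (hX.false x).elim⟩
  have hb : ∀ x, BddBelow (Set.range fun y => s * dist x y - ψ y) := fun x =>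
    ⟨φ x, by rintro _ ⟨y, rfl⟩; linarith [h x y]⟩
  refine ⟨fun x => ⨅ y, (s * dist x y - ψ y), LipschitzWith.of_le_add_mul _ fun x x' => ?_,
    fun x => ⟨le_ciInf fun y => by linarith [h x y], ?_⟩⟩
  · rw [← sub_le_iff_le_add]
    refine le_ciInf fun y => ?_
    have h1 := ciInf_le (hb x) y
    have h2 := mul_le_mul_of_nonneg_left (dist_triangle x x' y) s.coe_nonneg
    linarith
  · refine (ciInf_le (hb x) x).trans ?_
    simp

theorem ContinuousMap.integrable_of_compactSpace {X : Type*} [TopologicalSpace X] [CompactSpace X]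
    [MeasurableSpace X] [BorelSpace X] (φ : C(X, ℝ)) (m : Measure X) [IsFiniteMeasure m] :
    Integrable φ m :=
  φ.continuous.integrable_of_hasCompactSupport (HasCompactSupport.of_compactSpace _)

/-- Lower bound that makes the sublinear functional of `exists_coupling_integral_dist_le` finite: if
`a ≤ φ ⊕ ψ + s d` pointwise, then `a ≤ ∫ φ dm + ∫ ψ dn + s D`, where `D` bounds `∫ u dm - ∫ u dn`
over all 1-Lipschitz functions `u`. -/
theorem le_integral_add_integral {X : Type*} [MetricSpace X] [CompactSpace X]
    [MeasurableSpace X] [BorelSpace X] {m n : Measure X} [IsProbabilityMeasure m]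
    [IsProbabilityMeasure n] {s : NNReal} {D a : ℝ}
    (hD : ∀ u : X → ℝ, LipschitzWith 1 u → (∫ x, u x ∂m) - (∫ x, u x ∂n) ≤ D) (φ ψ : C(X, ℝ))
    (h : ∀ x y, a ≤ φ x + ψ y + s * dist x y) :
    a ≤ (∫ x, φ x ∂m) + (∫ x, ψ x ∂n) + s * D := by
  obtain ⟨u, hu, hφψ⟩ := exists_lipschitz_between (φ := .const X a - φ) (ψ := -ψ) (s := s)
    (fun x y => by simpa using by linarith [h x y])
  have hI : ∀ (k : Measure X) [IsFiniteMeasure k], Integrable u k := fun k _ =>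
    (ContinuousMap.mk u hu.continuous).integrable_of_compactSpace k
  have hsD : (∫ x, u x ∂m) - (∫ x, u x ∂n) ≤ s * D := by
    rcases eq_or_ne s 0 with rfl | hs
    · obtain ⟨x₀⟩ : Nonempty X := nonempty_of_isProbabilityMeasure m
      have : u = fun _ => u x₀ := funext fun x => by
        have := hu.dist_le_mul x x₀
        simpa using this
      rw [this]; simp
    · have hv : LipschitzWith 1 (fun x => (s : ℝ)⁻¹ * u x) := by
        refine LipschitzWith.of_dist_le_mul fun x y => ?_
        have h1 := hu.dist_le_mul x y
        have hs' : (0 : ℝ) < s := by positivity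
        rw [Real.dist_eq, ← mul_sub, abs_mul, abs_of_pos (inv_pos.2 hs'), NNReal.coe_one, one_mul,
          inv_mul_le_iff₀ hs', ← Real.dist_eq]
        exact h1
      have h1 := hD _ hv
      rw [integral_const_mul, integral_const_mul, ← mul_sub, inv_mul_le_iff₀ (by positivity)] at h1
      exact h1
  have h1 : a - ∫ x, φ x ∂m ≤ ∫ x, u x ∂m := by
    have := integral_mono ((integrable_const a).sub (φ.integrable_of_compactSpace m)) (hI m)
      (fun x => (hφψ x).1)
    rw [integral_sub' (integrable_const a) (φ.integrable_of_compactSpace m)] at this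
    simpa using this
  have h2 : ∫ x, u x ∂n ≤ ∫ x, ψ x ∂n :=
    integral_mono (hI n) (ψ.integrable_of_compactSpace n) (fun x => by simpa using (hφψ x).2)
  linarith

open CompactlySupported in
/-- Kantorovich–Rubinstein duality on a compact metric space: every bound `D` for `∫ u dm - ∫ u dn`
over 1-Lipschitz `u` also bounds the cost of some coupling. The coupling is the Riesz measure of a
linear functional on `C(X × X)` that Hahn–Banach finds below
`h ↦ inf {∫ φ dm + ∫ ψ dn + s D : h ≤ φ ⊕ ψ + s d, s ≥ 0}`. -/
theorem exists_coupling_integral_dist_le {X : Type*} [MetricSpace X] [CompactSpace X]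
    [MeasurableSpace X] [BorelSpace X] {m n : Measure X} [IsProbabilityMeasure m]
    [IsProbabilityMeasure n] {D : ℝ}
    (hD : ∀ u : X → ℝ, LipschitzWith 1 u → (∫ x, u x ∂m) - (∫ x, u x ∂n) ≤ D) :
    ∃ γ : Measure (X × X), IsFiniteMeasure γ ∧ γ.map Prod.fst = m ∧ γ.map Prod.snd = n ∧
      ∫ p, dist p.1 p.2 ∂γ ≤ D := by
  let S : C_c(X × X, ℝ) → Set ℝ := fun h => {r | ∃ (φ ψ : C(X, ℝ)) (s : NNReal),
    (∀ x y, h (x, y) ≤ φ x + ψ y + s * dist x y) ∧ r = (∫ x, φ x ∂m) + (∫ x, ψ x ∂n) + s * D}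
  let N : C_c(X × X, ℝ) → ℝ := fun h => sInf (S h)
  have hcpt : ∀ h : C_c(X × X, ℝ), ∃ M, ∀ z, |h z| ≤ M := fun h => by
    obtain ⟨M, hM⟩ := (isCompact_range h.continuous).isBounded.exists_norm_le
    exact ⟨M, fun z => hM _ ⟨z, rfl⟩⟩
  have hne : ∀ h, (S h).Nonempty := fun h => by
    obtain ⟨M, hM⟩ := hcpt h
    exact ⟨_, .const X M, 0, 0, fun x y => by simpa using (abs_le.1 (hM (x, y))).2, rfl⟩
  have hbd : ∀ h, BddBelow (S h) := fun h => by
    obtain ⟨M, hM⟩ := hcpt h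
    refine ⟨-M, ?_⟩
    rintro r ⟨φ, ψ, s, hh, rfl⟩
    exact le_integral_add_integral hD φ ψ fun x y => (abs_le.1 (hM (x, y))).1.trans (hh x y)
  have hle : ∀ (h : C_c(X × X, ℝ)) (φ ψ : C(X, ℝ)) (s : NNReal),
      (∀ x y, h (x, y) ≤ φ x + ψ y + s * dist x y) →
      N h ≤ (∫ x, φ x ∂m) + (∫ x, ψ x ∂n) + s * D :=
    fun h φ ψ s hh => csInf_le (hbd h) ⟨φ, ψ, s, hh, rfl⟩
  have hsmul_le : ∀ c : ℝ, 0 < c → ∀ h, N (c • h) ≤ c * N h := by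
    intro c hc h
    rw [← inv_mul_le_iff₀ hc]
    refine le_csInf (hne h) ?_
    rintro r ⟨φ, ψ, s, hh, rfl⟩
    rw [inv_mul_le_iff₀ hc]
    refine (hle (c • h) (c • φ) (c • ψ) (c.toNNReal * s) fun x y => ?_).trans_eq ?_
    · have := mul_le_mul_of_nonneg_left (hh x y) hc.le
      simp only [CompactlySupportedContinuousMap.coe_smul, Pi.smul_apply, smul_eq_mul,
        ContinuousMap.coe_smul, NNReal.coe_mul, Real.coe_toNNReal c hc.le]
      linarith
    · simp only [ContinuousMap.coe_smul, Pi.smul_apply, smul_eq_mul, integral_const_mul,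
        NNReal.coe_mul, Real.coe_toNNReal c hc.le]
      ring
  -- the trivial functional on the zero subspace is extended: `Λ ≤ N` alone carries all that is needed
  obtain ⟨Λ, -, hΛ⟩ := exists_extension_of_le_sublinear (⊥ : C_c(X × X, ℝ) →ₗ.[ℝ] ℝ) N
    (fun c hc h => by
      refine le_antisymm (hsmul_le c hc h) ?_
      have := hsmul_le c⁻¹ (inv_pos.2 hc) (c • h)
      rwa [smul_smul, inv_mul_cancel₀ hc.ne', one_smul, le_inv_mul_iff₀ hc] at this)
    (fun h h' => by
      rw [← sub_le_iff_le_add]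
      refine le_csInf (hne h) ?_
      rintro r ⟨φ, ψ, s, hh, rfl⟩
      rw [sub_le_comm]
      refine le_csInf (hne h') ?_
      rintro r ⟨φ', ψ', s', hh', rfl⟩
      rw [sub_le_iff_le_add]
      refine (hle (h + h') (φ + φ') (ψ + ψ') (s + s') fun x y => ?_).trans_eq ?_
      · have h1 := hh x y
        have h2 := hh' x y
        simp only [CompactlySupportedContinuousMap.coe_add, Pi.add_apply, ContinuousMap.coe_add,
          NNReal.coe_add]
        linarith
      · simp only [ContinuousMap.coe_add, Pi.add_apply, NNReal.coe_add]
        rw [integral_add (φ.integrable_of_compactSpace m) (φ'.integrable_of_compactSpace m),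
          integral_add (ψ.integrable_of_compactSpace n) (ψ'.integrable_of_compactSpace n)]
        ring)
    (fun x => by
      have hx : (x : C_c(X × X, ℝ)) = 0 := (Submodule.mem_bot ℝ).1 x.2
      have h0 : (⊥ : C_c(X × X, ℝ) →ₗ.[ℝ] ℝ) x = 0 := by
        have : x = 0 := Subtype.ext hx
        rw [this]; exact map_zero _
      rw [h0]
      refine le_csInf (hne _) ?_
      rintro r ⟨φ, ψ, s, hh, rfl⟩
      refine le_integral_add_integral hD φ ψ fun a b => ?_
      have := hh a b
      rwa [hx] at this)
  -- `h ≤ 0` admits `φ = ψ = 0` and `s = 0`, so `Λ h ≤ N h ≤ 0`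
  let P : C_c(X × X, ℝ) →ₚ[ℝ] ℝ := PositiveLinearMap.mk₀ Λ fun h hh => by
    have := (hΛ (-h)).trans (hle (-h) 0 0 0 fun x y => by
      simpa using hh (x, y))
    simpa using this
  let cc : C(X × X, ℝ) → C_c(X × X, ℝ) := fun f => ⟨f, HasCompactSupport.of_compactSpace _⟩
  have hfin : IsFiniteMeasure (RealRMK.rieszMeasure P) :=
    ⟨isCompact_univ.measure_lt_top⟩
  have hint : ∀ f : C(X × X, ℝ), ∫ z, f z ∂(RealRMK.rieszMeasure P) = Λ (cc f) :=
    fun f => RealRMK.integral_rieszMeasure P (cc f)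
  -- marginals: `Λ (φ ∘ fst) ≤ ∫ φ dm` for `φ` and for `-φ`; cost: `φ = ψ = 0`, `s = 1`
  refine ⟨RealRMK.rieszMeasure P, hfin, ?_, ?_, ?_⟩
  · have hle1 : ∀ φ : C(X, ℝ), Λ (cc (φ.comp .fst)) ≤ ∫ x, φ x ∂m := fun φ =>
      (hΛ _).trans ((hle _ φ 0 0 fun x y => by simp [cc]).trans_eq (by simp))
    refine ext_of_forall_integral_eq_of_IsFiniteMeasure fun f => ?_
    rw [integral_map measurable_fst.aemeasurable f.continuous.aestronglyMeasurable]
    refine (hint (f.toContinuousMap.comp .fst)).trans (le_antisymm (hle1 f.toContinuousMap) ?_)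
    have h2 := hle1 (-f.toContinuousMap)
    have h3 : cc ((-f.toContinuousMap).comp .fst) = -cc (f.toContinuousMap.comp .fst) := by
      ext; simp [cc]
    rw [h3, map_neg] at h2
    simp only [ContinuousMap.coe_neg, Pi.neg_apply, integral_neg] at h2
    exact neg_le_neg_iff.1 h2
  · have hle1 : ∀ φ : C(X, ℝ), Λ (cc (φ.comp .snd)) ≤ ∫ x, φ x ∂n := fun φ =>
      (hΛ _).trans ((hle _ 0 φ 0 fun x y => by simp [cc]).trans_eq (by simp))
    refine ext_of_forall_integral_eq_of_IsFiniteMeasure fun f => ?_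
    rw [integral_map measurable_snd.aemeasurable f.continuous.aestronglyMeasurable]
    refine (hint (f.toContinuousMap.comp .snd)).trans (le_antisymm (hle1 f.toContinuousMap) ?_)
    have h2 := hle1 (-f.toContinuousMap)
    have h3 : cc ((-f.toContinuousMap).comp .snd) = -cc (f.toContinuousMap.comp .snd) := by
      ext; simp [cc]
    rw [h3, map_neg] at h2
    simp only [ContinuousMap.coe_neg, Pi.neg_apply, integral_neg] at h2
    exact neg_le_neg_iff.1 h2
  · refine (hint ⟨fun p => dist p.1 p.2, by fun_prop⟩).trans_le ((hΛ _).trans ?_)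
    exact (hle _ 0 0 1 fun x y => by simp [cc]).trans_eq (by simp)

/-! ### Transport maps of atomless measures -/

open Set Filter Topology ProbabilityTheory unitInterval in
/-- The cumulative distribution function of an atomless law on `ℝ`, as a map into `[0, 1]`, pushes the
law to the uniform one. -/
theorem exists_map_eq_volume_unitInterval (m : Measure ℝ) [IsProbabilityMeasure m]
    [NullSingletonClass m] :
    ∃ F : ℝ → I, Measurable F ∧ m.map F = volume := by
  let F : ℝ → I := fun x => ⟨cdf m x, cdf_nonneg m x, cdf_le_one m x⟩
  have hF : Measurable F := (monotone_cdf m).measurable.subtype_mk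
  -- the jumps of the distribution function are the atoms of `m`
  have hcont : Continuous (cdf m) := by
    refine continuous_iff_continuousAt.2 fun x => ?_
    rw [(monotone_cdf m).continuousAt_iff_leftLim_eq_rightLim, (cdf m).rightLim_eq]
    have h1 := (cdf m).measure_singleton x
    rw [measure_cdf, measure_singleton, eq_comm, ENNReal.ofReal_eq_zero] at h1
    exact le_antisymm ((monotone_cdf m).leftLim_le le_rfl) (by linarith)
  have hsurj : ∀ t ∈ Ioo (0 : ℝ) 1, ∃ c, cdf m c = t := fun t ht =>
    mem_range_of_exists_le_of_exists_ge hcont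
      ((tendsto_cdf_atBot m).eventually_le_const ht.1).exists
      ((tendsto_cdf_atTop m).eventually_const_le ht.2).exists
  refine ⟨F, hF, ?_⟩
  have := Measure.isProbabilityMeasure_map (μ := m) hF.aemeasurable
  refine Measure.ext_of_Iic _ _ fun t => ?_
  rw [Measure.map_apply hF measurableSet_Iic, unitInterval.volume_Iic]
  refine le_antisymm ?_ ?_
  · rcases eq_or_lt_of_le t.2.2 with h1 | h1
    · rw [h1, ENNReal.ofReal_one]; exact prob_le_one
    · refine le_of_forall_gt fun b hb => ?_
      obtain ⟨s, hs, hsb⟩ : ∃ s ∈ Ioo (t : ℝ) 1, ENNReal.ofReal s < b := by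
        have h2 : ∀ᶠ s in 𝓝[>] (t : ℝ), ENNReal.ofReal s < b :=
          (ENNReal.continuous_ofReal.tendsto (t : ℝ)).mono_left nhdsWithin_le_nhds
            |>.eventually_lt_const hb
        exact (Filter.Eventually.and (Ioo_mem_nhdsGT h1) h2).exists
      obtain ⟨c, hc⟩ := hsurj s ⟨t.2.1.trans_lt hs.1, hs.2⟩
      refine (measure_mono fun x hx => ?_).trans_lt (by
        rwa [← hc, ofReal_cdf] at hsb : m (Iic c) < b)
      by_contra hxc
      have h3 : cdf m c ≤ cdf m x := monotone_cdf m (not_le.1 hxc).le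
      have h4 : cdf m x ≤ t := hx
      linarith [hs.1]
  · rcases eq_or_lt_of_le t.2.2 with h1 | h1
    · have : F ⁻¹' Iic t = univ := eq_univ_of_forall fun x => by
        change cdf m x ≤ t
        rw [h1]; exact cdf_le_one m x
      simp [this, h1]
    · rcases eq_or_lt_of_le t.2.1 with h0 | h0
      · simp [← h0]
      · obtain ⟨c, hc⟩ := hsurj t ⟨h0, h1⟩
        rw [← hc, ofReal_cdf]
        refine measure_mono fun x hx => ?_
        change cdf m x ≤ t
        rw [← hc]; exact monotone_cdf m hx

/-- An atomless finite measure can be mapped to every measure of the same mass. The map factors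
through the uniform law on `[0, 1]`. -/
theorem exists_measurable_map_eq_of_noAtoms {X Y : Type*} [MeasurableSpace X]
    [StandardBorelSpace X] [MeasurableSpace Y] [StandardBorelSpace Y] [Nonempty Y]
    (m : Measure X) [IsFiniteMeasure m] [NullSingletonClass m] (n : Measure Y)
    (h : m Set.univ = n Set.univ) :
    ∃ T : X → Y, Measurable T ∧ m.map T = n := by
  rcases eq_or_ne m 0 with rfl | hm
  · refine ⟨fun _ => Classical.arbitrary Y, measurable_const, ?_⟩
    rw [Measure.map_zero, eq_comm, ← Measure.measure_univ_eq_zero, ← h]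
    simp
  have hM0 : m Set.univ ≠ 0 := by simpa using hm
  have hMt : m Set.univ ≠ ∞ := measure_ne_top _ _
  have hp : IsProbabilityMeasure ((m Set.univ)⁻¹ • m) :=
    ⟨by simp [ENNReal.inv_mul_cancel hM0 hMt]⟩
  have hq : IsProbabilityMeasure ((m Set.univ)⁻¹ • n) :=
    ⟨by simp [← h, ENNReal.inv_mul_cancel hM0 hMt]⟩
  obtain ⟨e, he⟩ := MeasureTheory.exists_measurableEmbedding_real X
  have hpe := Measure.isProbabilityMeasure_map (μ := (m Set.univ)⁻¹ • m) he.measurable.aemeasurable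
  have hna : NullSingletonClass (((m Set.univ)⁻¹ • m).map e) := ⟨fun x => by
    rw [Measure.map_apply he.measurable (measurableSet_singleton x), Measure.smul_apply,
      (Set.subsingleton_singleton.preimage he.injective).measure_zero, smul_zero]⟩
  obtain ⟨F, hF, hFm⟩ := exists_map_eq_volume_unitInterval (((m Set.univ)⁻¹ • m).map e)
  obtain ⟨f, hf, hfm⟩ := Measure.exists_measurable_map_eq ((m Set.univ)⁻¹ • n)
  have hT := hf.comp (hF.comp he.measurable)
  refine ⟨_, hT, ?_⟩
  rw [← hFm, Measure.map_map hF he.measurable, Measure.map_map hf (hF.comp he.measurable),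
    Measure.map_smul] at hfm
  have := congrArg (fun k => m Set.univ • k) hfm
  simpa [smul_smul, ENNReal.mul_inv_cancel hM0 hMt] using this

/-- A countable measurable partition into cells `q ⁻¹' {i}`, each within distance `ε` of a point `c i`. -/
theorem exists_measurable_index_enorm_sub_le (d : ℕ) {ε : ℝ} (hε : 0 < ε) :
    ∃ (c : ℕ → Euc d) (q : Euc d → ℕ), Measurable q ∧ ∀ x, ‖x - c (q x)‖ₑ ≤ ENNReal.ofReal ε := by
  classical
  have hex : ∀ x : Euc d, ∃ k, dist x (TopologicalSpace.denseSeq (Euc d) k) < ε := fun x =>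
    (TopologicalSpace.denseRange_denseSeq (Euc d)).exists_dist_lt x hε
  refine ⟨TopologicalSpace.denseSeq (Euc d), fun x => Nat.find (hex x),
    measurable_find hex fun k => measurableSet_lt (by fun_prop) measurable_const, fun x => ?_⟩
  rw [← ofReal_norm, ← dist_eq_norm]
  exact ENNReal.ofReal_le_ofReal (Nat.find_spec (hex x)).le

/-- Every transport plan of an atomless measure can be replaced by a transport map at an arbitrarily
small extra cost: on a cell of diameter `≤ 2ε`, any map onto the second marginal of the plan
restricted to that cell will do. -/
theorem exists_map_lintegral_le {d : ℕ} {μ ν : Measure (Euc d)} [IsFiniteMeasure μ]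
    [NullSingletonClass μ]
    {γ : Measure (Euc d × Euc d)} (hγ : γ ∈ transportPlans μ ν) {ε : ℝ} (hε : 0 < ε) :
    ∃ T : Euc d → Euc d, Measurable T ∧ μ.map T = ν ∧
      transportCost μ T ≤ (∫⁻ p, ‖p.1 - p.2‖ₑ ∂γ) + 2 * ENNReal.ofReal ε * μ Set.univ := by
  obtain ⟨c, q, hq, hc⟩ := exists_measurable_index_enorm_sub_le d hε
  have hC : ∀ i, MeasurableSet (q ⁻¹' {i}) := fun i => hq (measurableSet_singleton i)
  have hCu : ⋃ i, q ⁻¹' {i} = Set.univ := by ext; simp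
  have hCd : Pairwise (Function.onFun Disjoint fun i => q ⁻¹' {i}) := fun i j hij =>
    Disjoint.preimage _ (by simpa using hij)
  have hD : ∀ i, MeasurableSet (Prod.fst ⁻¹' (q ⁻¹' {i}) : Set (Euc d × Euc d)) := fun i =>
    measurable_fst (hC i)
  have hDu : ⋃ i, (Prod.fst ⁻¹' (q ⁻¹' {i}) : Set (Euc d × Euc d)) = Set.univ := by ext; simp
  have hDd : Pairwise (Function.onFun Disjoint
      fun i => (Prod.fst ⁻¹' (q ⁻¹' {i}) : Set (Euc d × Euc d))) := fun i j hij =>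
    Disjoint.preimage _ (hCd hij)
  have hμs : ∀ i, μ.restrict (q ⁻¹' {i}) =
      (γ.restrict (Prod.fst ⁻¹' (q ⁻¹' {i}))).map Prod.fst := fun i => by
    rw [← Measure.restrict_map measurable_fst (hC i), hγ.1]
  choose t ht htm using fun i => exists_measurable_map_eq_of_noAtoms (μ.restrict (q ⁻¹' {i}))
    ((γ.restrict (Prod.fst ⁻¹' (q ⁻¹' {i}))).map Prod.snd) (by
      rw [hμs i, Measure.map_apply measurable_fst .univ, Measure.map_apply measurable_snd .univ]
      rfl)
  have hT : Measurable fun x => t (q x) x :=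
    (measurable_from_prod_countable_right (f := fun p : ℕ × Euc d => t p.1 p.2) ht).comp
      (hq.prodMk measurable_id)
  have hTi : ∀ i, (fun x => t (q x) x) =ᵐ[μ.restrict (q ⁻¹' {i})] t i := fun i => by
    filter_upwards [ae_restrict_mem (hC i)] with x hx
    rw [hx]
  have hμsum : μ = Measure.sum fun i => μ.restrict (q ⁻¹' {i}) := by
    rw [← Measure.restrict_iUnion hCd hC, hCu, Measure.restrict_univ]
  have hγsum : γ = Measure.sum fun i => γ.restrict (Prod.fst ⁻¹' (q ⁻¹' {i})) := by
    rw [← Measure.restrict_iUnion hDd hD, hDu, Measure.restrict_univ]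
  refine ⟨_, hT, ?_, ?_⟩
  · rw [← hγ.2]
    conv_lhs => rw [hμsum]
    conv_rhs => rw [hγsum]
    rw [Measure.map_sum hT.aemeasurable, Measure.map_sum measurable_snd.aemeasurable]
    congr 1
    funext i
    rw [Measure.map_congr (hTi i), htm i]
  · have key : ∀ i, ∫⁻ x in q ⁻¹' {i}, ‖x - t (q x) x‖ₑ ∂μ ≤
        (∫⁻ p in Prod.fst ⁻¹' (q ⁻¹' {i}), ‖p.1 - p.2‖ₑ ∂γ) +
          2 * ENNReal.ofReal ε * μ (q ⁻¹' {i}) := by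
      intro i
      have htri : ∀ a b e : Euc d, ‖a - e‖ₑ ≤ ‖a - b‖ₑ + ‖b - e‖ₑ := fun a b e => by
        simpa [edist_eq_enorm_sub] using edist_triangle a b e
      have hγm : γ (Prod.fst ⁻¹' (q ⁻¹' {i})) = μ (q ⁻¹' {i}) := by
        rw [← hγ.1, Measure.map_apply measurable_fst (hC i)]
      calc ∫⁻ x in q ⁻¹' {i}, ‖x - t (q x) x‖ₑ ∂μ
          ≤ ∫⁻ x in q ⁻¹' {i}, (ENNReal.ofReal ε + ‖c i - t i x‖ₑ) ∂μ := by
            refine setLIntegral_mono' (hC i) fun x hx => ?_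
            have hx' : q x = i := hx
            have := hc x
            rw [hx'] at this ⊢
            exact (htri x (c i) _).trans (by gcongr)
        _ = ENNReal.ofReal ε * μ (q ⁻¹' {i}) +
            ∫⁻ y, ‖c i - y‖ₑ ∂((μ.restrict (q ⁻¹' {i})).map (t i)) := by
            rw [lintegral_add_left measurable_const, setLIntegral_const,
              lintegral_map (by fun_prop) (ht i)]
        _ = ENNReal.ofReal ε * μ (q ⁻¹' {i}) +
            ∫⁻ p in Prod.fst ⁻¹' (q ⁻¹' {i}), ‖c i - p.2‖ₑ ∂γ := by
            rw [htm i, lintegral_map (by fun_prop) measurable_snd]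
        _ ≤ ENNReal.ofReal ε * μ (q ⁻¹' {i}) +
            ∫⁻ p in Prod.fst ⁻¹' (q ⁻¹' {i}), (ENNReal.ofReal ε + ‖p.1 - p.2‖ₑ) ∂γ := by
            refine add_le_add_right ?_ _
            refine setLIntegral_mono' (hD i) fun p hp => ?_
            have hp' : q p.1 = i := hp
            have := hc p.1
            rw [hp', ← enorm_neg, neg_sub] at this
            exact (htri _ p.1 _).trans (by gcongr)
        _ = _ := by
            rw [lintegral_add_left measurable_const, setLIntegral_const, hγm]
            ring
    have hμu : μ Set.univ = ∑' i, μ (q ⁻¹' {i}) := by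
      rw [← hCu, measure_iUnion hCd hC]
    calc transportCost μ (fun x => t (q x) x)
        = ∑' i, ∫⁻ x in q ⁻¹' {i}, ‖x - t (q x) x‖ₑ ∂μ := by
          rw [transportCost, ← lintegral_iUnion hC hCd, hCu, Measure.restrict_univ]
      _ ≤ _ := ENNReal.tsum_le_tsum key
      _ = _ := by
          rw [ENNReal.tsum_add, ENNReal.tsum_mul_left, ← hμu, ← lintegral_iUnion hD hDd, hDu,
            Measure.restrict_univ]

/-! ### Potentials with slope one along a coupling -/

open Filter Topology in
/-- A sequence of 1-Lipschitz functions that vanish at a common point converges pointwise along an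
ultrafilter, to a 1-Lipschitz function. -/
theorem exists_lipschitzWith_limit {X : Type*} [PseudoMetricSpace X] {v : ℕ → X → ℝ}
    (hv : ∀ k, LipschitzWith 1 (v k)) {x₀ : X} (h₀ : ∀ k, v k x₀ = 0) :
    ∃ u : X → ℝ, LipschitzWith 1 u ∧ ∀ x, Tendsto (fun k => v k x) (hyperfilter ℕ) (𝓝 (u x)) := by
  have hb : ∀ x k, v k x ∈ Set.Icc (-dist x x₀) (dist x x₀) := fun x k => by
    have := (hv k).dist_le_mul x x₀
    rw [h₀, Real.dist_eq, sub_zero, NNReal.coe_one, one_mul] at this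
    exact abs_le.1 this
  have hlim : ∀ x, ∃ a, Tendsto (fun k => v k x) (hyperfilter ℕ) (𝓝 a) := fun x => by
    obtain ⟨a, -, ha⟩ := isCompact_Icc.ultrafilter_le_nhds ((hyperfilter ℕ).map fun k => v k x)
      (le_principal_iff.2 (Eventually.of_forall (hb x) :
        ∀ᶠ k in (hyperfilter ℕ : Filter ℕ), v k x ∈ Set.Icc (-dist x x₀) (dist x x₀)))
    exact ⟨a, ha⟩
  choose u hu using hlim
  refine ⟨u, LipschitzWith.of_dist_le_mul fun x y => ?_, hu⟩
  exact le_of_tendsto ((hu x).dist (hu y)) (Eventually.of_forall fun k => (hv k).dist_le_mul x y)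

theorem IsProbOn.ae_mem {d : ℕ} {Ω : Set (Euc d)} {μ : Measure (Euc d)} (h : IsProbOn Ω μ) :
    ∀ᵐ x ∂μ, x ∈ Ω :=
  mem_ae_iff.2 h.2

theorem IsProbOn.restrict_eq {d : ℕ} {Ω : Set (Euc d)} {μ : Measure (Euc d)} (h : IsProbOn Ω μ) :
    μ.restrict Ω = μ :=
  Measure.restrict_eq_self_of_ae_mem h.ae_mem

theorem IsProbOn.nonempty {d : ℕ} {Ω : Set (Euc d)} {μ : Measure (Euc d)} (h : IsProbOn Ω μ) :
    Ω.Nonempty :=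
  have := h.1
  h.ae_mem.exists

theorem IsProbOn.integrable {d : ℕ} {Ω : Set (Euc d)} {μ : Measure (Euc d)} (h : IsProbOn Ω μ)
    (hΩ : IsCompact Ω) {f : Euc d → ℝ} (hf : Continuous f) : Integrable f μ := by
  have := h.1
  have := hf.continuousOn.integrableOn_compact (μ := μ) hΩ
  rwa [IntegrableOn, h.restrict_eq] at this

theorem integrable_norm_sub_of_ae_mem {d : ℕ} {Ω : Set (Euc d)} (hΩ : IsCompact Ω)
    {μ : Measure (Euc d)} [IsFiniteMeasure μ] {X Y : Euc d → Euc d} (hX : AEMeasurable X μ)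
    (hY : AEMeasurable Y μ) (hXΩ : ∀ᵐ x ∂μ, X x ∈ Ω) (hYΩ : ∀ᵐ x ∂μ, Y x ∈ Ω) :
    Integrable (fun x => ‖X x - Y x‖) μ := by
  refine Integrable.of_bound (hX.sub hY).norm.aestronglyMeasurable (Metric.diam Ω) ?_
  filter_upwards [hXΩ, hYΩ] with x h1 h2
  rw [norm_norm, ← dist_eq_norm]
  exact Metric.dist_le_diam_of_mem hΩ.isBounded h1 h2

theorem IsTransportMap.ae_mem {d : ℕ} {Ω : Set (Euc d)} {μ ν : Measure (Euc d)}
    {T : Euc d → Euc d} (h : IsTransportMap Ω μ ν T) (hμ : IsProbOn Ω μ) : ∀ᵐ x ∂μ, T x ∈ Ω := by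
  filter_upwards [hμ.ae_mem] with x hx using h.2.1 hx

/-- Monge's and Kantorovich's problems have the same value for atomless `μ`: an optimal map costs no
more than any plan. -/
theorem IsOptimalMap.transportCost_le {d : ℕ} {Ω : Set (Euc d)}
    {μ ν : Measure (Euc d)} (hμ : IsProbOn Ω μ) (hν : IsProbOn Ω ν) [NullSingletonClass μ]
    {T₀ : Euc d → Euc d} (hT₀ : IsOptimalMap Ω μ ν T₀) {γ : Measure (Euc d × Euc d)}
    (hγ : γ ∈ transportPlans μ ν) : transportCost μ T₀ ≤ ∫⁻ p, ‖p.1 - p.2‖ₑ ∂γ := by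
  classical
  have := hμ.1
  obtain ⟨x₀, hx₀⟩ := hμ.nonempty
  refine ENNReal.le_of_forall_pos_le_add fun ε hε _ => ?_
  obtain ⟨T, hT, hTν, hcost⟩ := exists_map_lintegral_le hγ (ε := ε / 2) (by positivity)
  have hTΩ : ∀ᵐ x ∂μ, T x ∈ Ω := ae_of_ae_map hT.aemeasurable (hTν ▸ hν.ae_mem)
  have hae : (fun x => if T x ∈ Ω then T x else x₀) =ᵐ[μ] T := by
    filter_upwards [hTΩ] with x hx using if_pos hx
  have hadm : IsTransportMap Ω μ ν (fun x => if T x ∈ Ω then T x else x₀) := by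
    refine ⟨hT.aemeasurable.congr hae.symm, fun x _ => ?_, by rw [Measure.map_congr hae, hTν]⟩
    dsimp only
    split_ifs with h
    exacts [h, hx₀]
  refine (hT₀.2 _ hadm).trans ?_
  have h1 : transportCost μ (fun x => if T x ∈ Ω then T x else x₀) = transportCost μ T := by
    refine lintegral_congr_ae ?_
    filter_upwards [hae] with x hx
    rw [hx]
  rw [h1]
  refine hcost.trans_eq ?_
  rw [measure_univ, mul_one, two_mul, ← ENNReal.ofReal_add (by positivity) (by positivity),
    add_halves, ENNReal.ofReal_coe_nnreal]

/-- Approximate dual optimality: the values `∫ v dμ - ∫ v dν` of 1-Lipschitz functions `v` come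
arbitrarily close to the cost of an optimal map. -/
theorem IsOptimalMap.exists_lipschitz_integral_sub_gt {d : ℕ} {Ω : Set (Euc d)}
    (hΩ : IsCompact Ω) {μ ν : Measure (Euc d)} (hμ : IsProbOn Ω μ) (hν : IsProbOn Ω ν)
    [NullSingletonClass μ] {T₀ : Euc d → Euc d} (hT₀ : IsOptimalMap Ω μ ν T₀) {ε : ℝ}
    (hε : 0 < ε) :
    ∃ v : Euc d → ℝ, LipschitzWith 1 v ∧
      (∫ x, ‖x - T₀ x‖ ∂μ) - ε < (∫ x, v x ∂μ) - ∫ x, v x ∂ν := by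
  by_contra! hcon
  have := hμ.1
  have := hν.1
  have : CompactSpace Ω := isCompact_iff_compactSpace.1 hΩ
  have hΩm := hΩ.measurableSet
  have hemb := MeasurableEmbedding.subtype_coe hΩm
  have hmap : ∀ {k : Measure (Euc d)}, IsProbOn Ω k →
      (k.comap (Subtype.val : Ω → Euc d)).map Subtype.val = k := fun {k} hk => by
    rw [map_comap_subtype_coe hΩm, hk.restrict_eq]
  have hprob : ∀ {k : Measure (Euc d)}, IsProbOn Ω k →
      IsProbabilityMeasure (k.comap (Subtype.val : Ω → Euc d)) := fun {k} hk => by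
    have := hk.1
    refine ⟨?_⟩
    rw [hemb.comap_apply, Set.image_univ, Subtype.range_coe, ← Set.univ_inter Ω,
      ← Measure.restrict_apply' hΩm, hk.restrict_eq, measure_univ]
  have := hprob hμ
  have := hprob hν
  obtain ⟨γ, hγf, hγ1, hγ2, hγD⟩ := exists_coupling_integral_dist_le
    (m := μ.comap (Subtype.val : Ω → Euc d)) (n := ν.comap (Subtype.val : Ω → Euc d))
    (D := (∫ x, ‖x - T₀ x‖ ∂μ) - ε) (fun u hu => by
      have hw : LipschitzOnWith 1 (Function.extend Subtype.val u 0) Ω := by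
        rw [lipschitzOnWith_iff_restrict]
        rwa [show Ω.domRestrict (Function.extend Subtype.val u 0) = u from
          funext fun x => Subtype.val_injective.extend_apply u 0 x]
      obtain ⟨v, hv, hvw⟩ := hw.extend_real
      have huv : u = fun x => v x.1 := funext fun x => by
        rw [← hvw x.2, Subtype.val_injective.extend_apply]
      have hint : ∀ {k : Measure (Euc d)}, IsProbOn Ω k →
          ∫ x, u x ∂(k.comap (Subtype.val : Ω → Euc d)) = ∫ x, v x ∂k := fun {k} hk => by
        conv_rhs => rw [← hmap hk]
        rw [hemb.integral_map, huv]
      rw [hint hμ, hint hν]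
      exact hcon v hv)
  have hincl : Measurable (Prod.map Subtype.val Subtype.val : Ω × Ω → Euc d × Euc d) := by
    fun_prop
  have hplan : γ.map (Prod.map Subtype.val Subtype.val) ∈ transportPlans μ ν := by
    constructor
    · rw [Measure.map_map measurable_fst hincl]
      conv_rhs => rw [← hmap hμ, ← hγ1, Measure.map_map measurable_subtype_coe measurable_fst]
      rfl
    · rw [Measure.map_map measurable_snd hincl]
      conv_rhs => rw [← hmap hν, ← hγ2, Measure.map_map measurable_subtype_coe measurable_snd]
      rfl
  have hle := hT₀.transportCost_le hμ hν hplan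
  have hdint : Integrable (fun p : Ω × Ω => dist p.1 p.2) γ :=
    ContinuousMap.integrable_of_compactSpace ⟨fun p : Ω × Ω => dist p.1 p.2, by fun_prop⟩ γ
  have h2 : ∫⁻ p, ‖p.1 - p.2‖ₑ ∂(γ.map (Prod.map Subtype.val Subtype.val)) =
      ENNReal.ofReal (∫ p, dist p.1 p.2 ∂γ) := by
    rw [lintegral_map (by fun_prop) hincl,
      ofReal_integral_eq_lintegral_ofReal hdint (.of_forall fun _ => dist_nonneg)]
    refine lintegral_congr fun p => ?_
    rw [Subtype.dist_eq, dist_eq_norm, ofReal_norm]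
    rfl
  have h3 : transportCost μ T₀ = ENNReal.ofReal (∫ x, ‖x - T₀ x‖ ∂μ) := by
    rw [ofReal_integral_eq_lintegral_ofReal _ (.of_forall fun _ => norm_nonneg _)]
    · exact lintegral_congr fun x => (ofReal_norm _).symm
    · exact integrable_norm_sub_of_ae_mem hΩ aemeasurable_id hT₀.1.1 hμ.ae_mem
        (hT₀.1.ae_mem hμ)
  rw [h2, h3, ENNReal.ofReal_le_ofReal_iff (integral_nonneg fun _ => dist_nonneg)] at hle
  linarith

theorem LipschitzWith.sub_le_norm_sub {E : Type*} [SeminormedAddCommGroup E] {u : E → ℝ}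
    (hu : LipschitzWith 1 u) (x y : E) : u x - u y ≤ ‖x - y‖ := by
  have := hu.dist_le_mul x y
  rw [Real.dist_eq, NNReal.coe_one, one_mul, dist_eq_norm] at this
  exact (le_abs_self _).trans this

open Filter Topology in
/-- An optimal map has a 1-Lipschitz potential that decreases with slope one along almost every
transport segment `[x, T₀ x]`. It is the limit of a maximizing sequence `v k`, for which
`|x - T₀ x| - (v k x - v k (T₀ x))` is summable in `L¹` and so tends to zero almost everywhere. -/
theorem IsOptimalMap.exists_lipschitz_sub_eq_norm {d : ℕ} {Ω : Set (Euc d)}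
    (hΩ : IsCompact Ω) {μ ν : Measure (Euc d)} (hμ : IsProbOn Ω μ) (hν : IsProbOn Ω ν)
    [NullSingletonClass μ] {T₀ : Euc d → Euc d} (hT₀ : IsOptimalMap Ω μ ν T₀) :
    ∃ u : Euc d → ℝ, LipschitzWith 1 u ∧ ∀ᵐ x ∂μ, u x - u (T₀ x) = ‖x - T₀ x‖ := by
  have := hμ.1
  have := hν.1
  choose v hv hgap using fun k : ℕ => hT₀.exists_lipschitz_integral_sub_gt hΩ hμ hν
    (ε := (1 / 2 : ℝ) ^ k) (by positivity)
  obtain ⟨u, hu, hlim⟩ := exists_lipschitzWith_limit (v := fun k x => v k x - v k 0)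
    (fun k => LipschitzWith.of_dist_le_mul fun x y => by
      simpa using (hv k).dist_le_mul x y) (x₀ := 0) (fun k => sub_self _)
  refine ⟨u, hu, ?_⟩
  have hTi : ∀ k, Integrable (fun x => v k (T₀ x)) μ := fun k => by
    have := hν.integrable hΩ (hv k).continuous
    rw [← hT₀.1.2.2] at this
    exact this.comp_aemeasurable hT₀.1.1
  have hTint : ∀ k, ∫ x, v k (T₀ x) ∂μ = ∫ y, v k y ∂ν := fun k => by
    rw [← hT₀.1.2.2, integral_map hT₀.1.1 (hv k).continuous.aestronglyMeasurable]
  have hnorm : Integrable (fun x => ‖x - T₀ x‖) μ :=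
    integrable_norm_sub_of_ae_mem hΩ aemeasurable_id hT₀.1.1 hμ.ae_mem (hT₀.1.ae_mem hμ)
  have hgi : ∀ k, Integrable (fun x => ‖x - T₀ x‖ - (v k x - v k (T₀ x))) μ := fun k =>
    hnorm.sub ((hμ.integrable hΩ (hv k).continuous).sub (hTi k))
  have hg : ∀ k, ∫⁻ x, ENNReal.ofReal (‖x - T₀ x‖ - (v k x - v k (T₀ x))) ∂μ ≤
      ENNReal.ofReal ((1 / 2 : ℝ) ^ k) := fun k => by
    rw [← ofReal_integral_eq_lintegral_ofReal (hgi k)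
      (.of_forall fun x => sub_nonneg.2 ((hv k).sub_le_norm_sub _ _))]
    refine ENNReal.ofReal_le_ofReal ?_
    have h1 := integral_sub hnorm ((hμ.integrable hΩ (hv k).continuous).sub (hTi k))
    have h2 := integral_sub (hμ.integrable hΩ (hv k).continuous) (hTi k)
    simp only [Pi.sub_apply] at h1
    rw [h1, h2, hTint]
    linarith [hgap k]
  have hsum : ∀ᵐ x ∂μ, ∑' k, ENNReal.ofReal (‖x - T₀ x‖ - (v k x - v k (T₀ x))) < ∞ := by
    refine ae_lt_top' (AEMeasurable.tsum fun k => (hgi k).aemeasurable.ennreal_ofReal) ?_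
    rw [lintegral_tsum fun k => (hgi k).aemeasurable.ennreal_ofReal]
    refine ne_top_of_le_ne_top ?_ (ENNReal.tsum_le_tsum hg)
    rw [← ENNReal.ofReal_tsum_of_nonneg (fun k => by positivity) summable_geometric_two]
    exact ENNReal.ofReal_ne_top
  filter_upwards [hsum] with x hx
  have h1 := ENNReal.tendsto_atTop_zero_of_tsum_ne_top hx.ne
  have h2 : Tendsto (fun k => ‖x - T₀ x‖ - (v k x - v k (T₀ x))) atTop (𝓝 0) := by
    have := (ENNReal.continuousAt_toReal ENNReal.zero_ne_top).tendsto.comp h1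
    refine this.congr fun k => ?_
    exact ENNReal.toReal_ofReal (sub_nonneg.2 ((hv k).sub_le_norm_sub _ _))
  have h3 := (h2.mono_left Nat.hyperfilter_le_atTop)
  have h4 := (tendsto_const_nhds (x := ‖x - T₀ x‖)).sub ((hlim x).sub (hlim (T₀ x)))
  have h5 := tendsto_nhds_unique (h3.congr fun k => by ring) h4
  linarith

/-- Weak duality, for an arbitrary plan and an arbitrary 1-Lipschitz function. -/
theorem integral_sub_le_integral_norm {d : ℕ} {Ω : Set (Euc d)} (hΩ : IsCompact Ω)
    {m n : Measure (Euc d)} (hm : IsProbOn Ω m) (hn : IsProbOn Ω n)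
    {γ : Measure (Euc d × Euc d)} (hγ : γ ∈ transportPlans m n)
    {v : Euc d → ℝ} (hv : LipschitzWith 1 v) :
    ENNReal.ofReal ((∫ x, v x ∂m) - ∫ x, v x ∂n) ≤ ∫⁻ p, ‖p.1 - p.2‖ₑ ∂γ := by
  have h1 : ∫ x, v x ∂m = ∫ p, v p.1 ∂γ := by
    rw [← hγ.1, integral_map measurable_fst.aemeasurable hv.continuous.aestronglyMeasurable]
  have h2 : ∫ x, v x ∂n = ∫ p, v p.2 ∂γ := by
    rw [← hγ.2, integral_map measurable_snd.aemeasurable hv.continuous.aestronglyMeasurable]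
  have i1 : Integrable (fun p => v p.1) γ := by
    have := hm.integrable hΩ hv.continuous
    rw [← hγ.1] at this
    exact this.comp_measurable measurable_fst
  have i2 : Integrable (fun p => v p.2) γ := by
    have := hn.integrable hΩ hv.continuous
    rw [← hγ.2] at this
    exact this.comp_measurable measurable_snd
  rw [h1, h2, ← integral_sub i1 i2]
  refine (ENNReal.ofReal_le_ofReal (le_abs_self _)).trans ?_
  rw [← Real.norm_eq_abs, ofReal_norm]
  refine (enorm_integral_le_lintegral_enorm _).trans (lintegral_mono fun p => ?_)
  rw [← edist_eq_enorm_sub, ← edist_eq_enorm_sub]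
  simpa using hv.edist_le_mul p.1 p.2

section Slope

variable {d : ℕ} {Ω : Set (Euc d)} {μ : Measure (Euc d)} {X Y : Euc d → Euc d} {u : Euc d → ℝ}

theorem integral_norm_sub_eq_of_slope (hΩ : IsCompact Ω) (hX : AEMeasurable X μ)
    (hY : AEMeasurable Y μ) (hm : IsProbOn Ω (μ.map X)) (hn : IsProbOn Ω (μ.map Y))
    (hu : LipschitzWith 1 u) (hslope : ∀ᵐ x ∂μ, u (X x) - u (Y x) = ‖X x - Y x‖) :
    ∫ x, ‖X x - Y x‖ ∂μ = (∫ x, u x ∂(μ.map X)) - ∫ x, u x ∂(μ.map Y) := by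
  rw [integral_map hX hu.continuous.aestronglyMeasurable,
    integral_map hY hu.continuous.aestronglyMeasurable, ← integral_sub]
  · exact integral_congr_ae (by filter_upwards [hslope] with x hx using hx.symm)
  · exact (hm.integrable hΩ hu.continuous).comp_aemeasurable hX
  · exact (hn.integrable hΩ hu.continuous).comp_aemeasurable hY

/-- A coupling `(X, Y)` along which some 1-Lipschitz function decreases with slope one is optimal. -/
theorem W1_eq_integral_of_slope [IsFiniteMeasure μ] (hΩ : IsCompact Ω) (hX : AEMeasurable X μ)
    (hY : AEMeasurable Y μ) (hm : IsProbOn Ω (μ.map X)) (hn : IsProbOn Ω (μ.map Y))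
    (hu : LipschitzWith 1 u) (hslope : ∀ᵐ x ∂μ, u (X x) - u (Y x) = ‖X x - Y x‖) :
    W1 (μ.map X) (μ.map Y) = ∫ x, ‖X x - Y x‖ ∂μ := by
  have hXY := hX.prodMk hY
  have hplan : μ.map (fun x => (X x, Y x)) ∈ transportPlans (μ.map X) (μ.map Y) :=
    ⟨by rw [AEMeasurable.map_map_of_aemeasurable measurable_fst.aemeasurable hXY]; rfl,
      by rw [AEMeasurable.map_map_of_aemeasurable measurable_snd.aemeasurable hXY]; rfl⟩
  have hint : Integrable (fun x => ‖X x - Y x‖) μ :=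
    integrable_norm_sub_of_ae_mem hΩ hX hY (ae_of_ae_map hX hm.ae_mem) (ae_of_ae_map hY hn.ae_mem)
  have hcost : ∫⁻ p, ‖p.1 - p.2‖ₑ ∂(μ.map fun x => (X x, Y x)) =
      ENNReal.ofReal (∫ x, ‖X x - Y x‖ ∂μ) := by
    rw [lintegral_map' (by fun_prop) hXY,
      ofReal_integral_eq_lintegral_ofReal hint (.of_forall fun _ => norm_nonneg _)]
    exact lintegral_congr fun x => (ofReal_norm _).symm
  have : (⨅ γ ∈ transportPlans (μ.map X) (μ.map Y), ∫⁻ p, ‖p.1 - p.2‖ₑ ∂γ) =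
      ENNReal.ofReal (∫ x, ‖X x - Y x‖ ∂μ) := by
    refine le_antisymm ((iInf₂_le _ hplan).trans_eq hcost) (le_iInf₂ fun γ hγ => ?_)
    rw [integral_norm_sub_eq_of_slope hΩ hX hY hm hn hu hslope]
    exact integral_sub_le_integral_norm hΩ hm hn hγ hu
  rw [W1, this, ENNReal.toReal_ofReal (integral_nonneg fun _ => norm_nonneg _)]

/-- A 1-Lipschitz function with slope one along some coupling is a Kantorovich potential for its
marginals. -/
theorem isKantorovichPotential_of_slope [IsFiniteMeasure μ] (hΩ : IsCompact Ω)
    (hX : AEMeasurable X μ)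
    (hY : AEMeasurable Y μ) (hm : IsProbOn Ω (μ.map X)) (hn : IsProbOn Ω (μ.map Y))
    (hu : LipschitzWith 1 u) (hslope : ∀ᵐ x ∂μ, u (X x) - u (Y x) = ‖X x - Y x‖) :
    IsKantorovichPotential Ω (μ.map X) (μ.map Y) u := by
  refine ⟨hu.lipschitzOnWith, fun v hv => ?_⟩
  obtain ⟨w, hw, hvw⟩ := hv.extend_real
  have hint : Integrable (fun x => ‖X x - Y x‖) μ :=
    integrable_norm_sub_of_ae_mem hΩ hX hY (ae_of_ae_map hX hm.ae_mem) (ae_of_ae_map hY hn.ae_mem)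
  have i1 := (hm.integrable hΩ hw.continuous).comp_aemeasurable hX
  have i2 := (hn.integrable hΩ hw.continuous).comp_aemeasurable hY
  rw [setIntegral_congr_fun hΩ.measurableSet hvw, setIntegral_congr_fun hΩ.measurableSet hvw,
    hm.restrict_eq, hn.restrict_eq, ← integral_norm_sub_eq_of_slope hΩ hX hY hm hn hu hslope,
    integral_map hX hw.continuous.aestronglyMeasurable,
    integral_map hY hw.continuous.aestronglyMeasurable, ← integral_sub]
  · exact integral_mono (i1.sub i2) hint fun x => hw.sub_le_norm_sub _ _
  · exact i1
  · exact i2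

/-- If one 1-Lipschitz function `u` has slope one along a coupling, then so has every Kantorovich
potential `v` of its marginals. Here `w` is a Lipschitz extension of `v` to the whole space. -/
theorem IsKantorovichPotential.slope [IsFiniteMeasure μ] (hΩ : IsCompact Ω)
    (hX : AEMeasurable X μ)
    (hY : AEMeasurable Y μ) (hm : IsProbOn Ω (μ.map X)) (hn : IsProbOn Ω (μ.map Y))
    (hu : LipschitzWith 1 u) (hslope : ∀ᵐ x ∂μ, u (X x) - u (Y x) = ‖X x - Y x‖)
    {v w : Euc d → ℝ} (hv : IsKantorovichPotential Ω (μ.map X) (μ.map Y) v)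
    (hw : LipschitzWith 1 w) (hvw : Set.EqOn v w Ω) :
    ∀ᵐ x ∂μ, w (X x) - w (Y x) = ‖X x - Y x‖ := by
  have hint : Integrable (fun x => ‖X x - Y x‖) μ :=
    integrable_norm_sub_of_ae_mem hΩ hX hY (ae_of_ae_map hX hm.ae_mem) (ae_of_ae_map hY hn.ae_mem)
  have i1 := (hm.integrable hΩ hw.continuous).comp_aemeasurable hX
  have i2 := (hn.integrable hΩ hw.continuous).comp_aemeasurable hY
  have h1 := hv.2 u hu.lipschitzOnWith
  rw [setIntegral_congr_fun hΩ.measurableSet hvw, setIntegral_congr_fun hΩ.measurableSet hvw,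
    hm.restrict_eq, hn.restrict_eq, ← integral_norm_sub_eq_of_slope hΩ hX hY hm hn hu hslope,
    integral_map hX hw.continuous.aestronglyMeasurable,
    integral_map hY hw.continuous.aestronglyMeasurable] at h1
  have h2 : ∫ x, (‖X x - Y x‖ - (w (X x) - w (Y x))) ∂μ = 0 := by
    refine le_antisymm ?_ (integral_nonneg fun x => sub_nonneg.2 (hw.sub_le_norm_sub _ _))
    have := integral_sub hint (i1.sub i2)
    have h3 := integral_sub i1 i2
    simp only [Pi.sub_apply, Function.comp_apply] at this h3
    rw [this, h3]
    linarith
  have h4 := (integral_eq_zero_iff_of_nonneg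
    (fun x => sub_nonneg.2 (hw.sub_le_norm_sub (X x) (Y x))) (hint.sub (i1.sub i2))).1 h2
  filter_upwards [h4] with x hx
  have : ‖X x - Y x‖ - (w (X x) - w (Y x)) = 0 := hx
  linarith

end Slope

/-! ### Gradients and Lipschitz regularity along transport rays -/

section TwoSidedRays

variable {E : Type*} [NormedAddCommGroup E] [InnerProductSpace ℝ E] {u : E → ℝ}

open scoped InnerProductSpace

/-- `y` is the midpoint of a segment of length `2δ` with direction `p` along which `u` increases with
slope one. -/
def IsRayDirection (u : E → ℝ) (δ : ℝ) (y p : E) : Prop :=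
  ‖p‖ = 1 ∧ u (y + δ • p) = u y + δ ∧ u (y - δ • p) = u y - δ

theorem norm_smul_add_le {δ : ℝ} (hδ : 0 < δ) {p : E} (hp : ‖p‖ = 1) (w : E) :
    ‖δ • p + w‖ ≤ δ + ⟪p, w⟫_ℝ + ‖w‖ ^ 2 / (2 * δ) := by
  have h1 : ‖δ • p + w‖ ^ 2 = δ ^ 2 + 2 * (δ * ⟪p, w⟫_ℝ) + ‖w‖ ^ 2 := by
    rw [norm_add_sq_real, norm_smul, hp, mul_one, Real.norm_eq_abs, sq_abs, real_inner_smul_left]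
  have h2 : δ + ⟪p, w⟫_ℝ + ‖w‖ ^ 2 / (2 * δ) = (‖δ • p + w‖ ^ 2 + δ ^ 2) / (2 * δ) := by
    rw [h1]; field_simp; ring
  rw [h2, le_div_iff₀ (by positivity)]
  nlinarith [sq_nonneg (‖δ • p + w‖ - δ)]

/-- At the midpoint of a slope-one segment a 1-Lipschitz function is squeezed between two paraboloids:
it lies below the cone with vertex `y - δ p` and above the one with vertex `y + δ p`. -/
theorem IsRayDirection.abs_sub_le (hu : LipschitzWith 1 u) {δ : ℝ} (hδ : 0 < δ) {y p : E}
    (h : IsRayDirection u δ y p) (w : E) :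
    |u (y + w) - u y - ⟪p, w⟫_ℝ| ≤ ‖w‖ ^ 2 / (2 * δ) := by
  obtain ⟨hp, h1, h2⟩ := h
  have h3 := hu.sub_le_norm_sub (y + w) (y - δ • p)
  have h4 := hu.sub_le_norm_sub (y + δ • p) (y + w)
  rw [show y + w - (y - δ • p) = δ • p + w by abel] at h3
  rw [show y + δ • p - (y + w) = δ • p + -w by abel] at h4
  have h5 := norm_smul_add_le hδ hp w
  have h6 := norm_smul_add_le hδ hp (-w)
  rw [inner_neg_right, norm_neg] at h6
  rw [abs_le]
  constructor <;> linarith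

/-- The direction of the rays depends on their midpoint in a Lipschitz way; in particular it is unique. -/
theorem IsRayDirection.norm_sub_le (hu : LipschitzWith 1 u) {δ : ℝ} (hδ : 0 < δ) {y y' p p' : E}
    (h : IsRayDirection u δ y p) (h' : IsRayDirection u δ y' p') :
    ‖p - p'‖ ≤ 3 / δ * ‖y - y'‖ := by
  obtain ⟨h₀, rfl⟩ : ∃ h₀, y' = y + h₀ := ⟨y' - y, by abel⟩
  rw [sub_add_cancel_left, norm_neg]
  rcases eq_or_ne p p' with rfl | hne
  · rw [sub_self, norm_zero]; positivity
  have hn : 0 < ‖p - p'‖ := norm_pos_iff.2 (sub_ne_zero.2 hne)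
  rcases eq_or_ne h₀ 0 with rfl | hh
  · -- with equal base points, compare the two expansions along a small multiple of `p - p'`
    rw [add_zero] at h'
    have a1 := (abs_le.1 (h.abs_sub_le hu hδ ((δ / 2) • (p - p')))).1
    have a2 := (abs_le.1 (h'.abs_sub_le hu hδ ((δ / 2) • (p - p')))).2
    have a3 : ⟪p, (δ / 2) • (p - p')⟫_ℝ - ⟪p', (δ / 2) • (p - p')⟫_ℝ = δ / 2 * ‖p - p'‖ ^ 2 := by
      rw [← inner_sub_left, real_inner_smul_right, real_inner_self_eq_norm_sq]
    have a4 : ‖(δ / 2) • (p - p')‖ ^ 2 / (2 * δ) = δ / 8 * ‖p - p'‖ ^ 2 := by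
      rw [norm_smul, Real.norm_eq_abs, abs_of_pos (by positivity)]; field_simp; ring
    rw [a4] at a1 a2
    nlinarith [mul_pos hδ (pow_pos hn 2)]
  have hh' : 0 < ‖h₀‖ := norm_pos_iff.2 hh
  -- the expansions are compared at `y + h₀ + w`, where `w` has the length of `h₀` and the direction
  -- of `p - p'`, which makes `⟪p - p', w⟫` as large as possible
  set w : E := (‖h₀‖ / ‖p - p'‖) • (p - p') with hw
  have hwn : ‖w‖ = ‖h₀‖ := by
    rw [hw, norm_smul, Real.norm_eq_abs, abs_of_pos (by positivity)]
    field_simp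
  have a1 := (abs_le.1 (h.abs_sub_le hu hδ (h₀ + w))).1
  have a2 := (abs_le.1 (h'.abs_sub_le hu hδ w)).2
  have a3 := (abs_le.1 (h.abs_sub_le hu hδ h₀)).2
  have a4 : ⟪p, w⟫_ℝ - ⟪p', w⟫_ℝ = ‖h₀‖ * ‖p - p'‖ := by
    rw [← inner_sub_left, hw, real_inner_smul_right, real_inner_self_eq_norm_sq]
    field_simp
  have a5 : ‖h₀ + w‖ ^ 2 ≤ 4 * ‖h₀‖ ^ 2 := by
    have := norm_add_le h₀ w
    rw [hwn] at this
    nlinarith [norm_nonneg (h₀ + w)]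
  rw [inner_add_right, ← add_assoc] at a1
  rw [hwn] at a2
  have a6 : ‖h₀ + w‖ ^ 2 / (2 * δ) ≤ 4 * ‖h₀‖ ^ 2 / (2 * δ) := by gcongr
  have a7 : ‖h₀‖ * ‖p - p'‖ ≤ ‖h₀‖ * (3 / δ * ‖h₀‖) := by
    have : ‖h₀‖ * (3 / δ * ‖h₀‖) =
        4 * ‖h₀‖ ^ 2 / (2 * δ) + ‖h₀‖ ^ 2 / (2 * δ) + ‖h₀‖ ^ 2 / (2 * δ) := by
      field_simp; ring
    linarith
  exact le_of_mul_le_mul_left a7 hh'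

end TwoSidedRays

section Moving

variable {E : Type*} [NormedAddCommGroup E] [NormedSpace ℝ E]

/-- The unit vector pointing from `z` to `x`, or zero if `x = z`. Hence `x - t • unitDir x z` is the
point reached from `x` after moving a distance `t` towards `z`. -/
noncomputable def unitDir (x z : E) : E := ‖x - z‖⁻¹ • (x - z)

theorem norm_unitDir {x z : E} (h : 0 < ‖x - z‖) : ‖unitDir x z‖ = 1 := by
  rw [unitDir, norm_smul, norm_inv, norm_norm, inv_mul_cancel₀ h.ne']

theorem norm_smul_unitDir (x z : E) : ‖x - z‖ • unitDir x z = x - z := by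
  rcases eq_or_ne (x - z) 0 with h | h
  · simp [unitDir, h]
  · rw [unitDir, smul_smul, mul_inv_cancel₀ (norm_ne_zero_iff.2 h), one_smul]

theorem sub_smul_unitDir_sub (x z : E) (t : ℝ) :
    x - t • unitDir x z - z = (‖x - z‖ - t) • unitDir x z := by
  rw [sub_smul, norm_smul_unitDir]; abel

theorem norm_sub_smul_unitDir_sub {x z : E} {t : ℝ} (h : 0 < ‖x - z‖) (ht : t ≤ ‖x - z‖) :
    ‖x - t • unitDir x z - z‖ = ‖x - z‖ - t := by
  rw [sub_smul_unitDir_sub, norm_smul, norm_unitDir h, mul_one, Real.norm_eq_abs,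
    abs_of_nonneg (by linarith)]

/-- Moving towards `z`, without reaching it, does not change the direction. -/
theorem unitDir_sub_smul {x z : E} {t : ℝ} (h : 0 < ‖x - z‖) (ht : t < ‖x - z‖) :
    unitDir (x - t • unitDir x z) z = unitDir x z := by
  rw [unitDir, norm_sub_smul_unitDir_sub h ht.le, sub_smul_unitDir_sub, smul_smul,
    inv_mul_cancel₀ (by linarith), one_smul]

theorem sub_smul_unitDir_mem {s : Set E} (hs : Convex ℝ s) {x z : E} (hx : x ∈ s) (hz : z ∈ s)
    {t : ℝ} (h : 0 < ‖x - z‖) (ht0 : 0 ≤ t) (ht : t ≤ ‖x - z‖) : x - t • unitDir x z ∈ s := by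
  have := hs.add_smul_sub_mem hx hz (t := t / ‖x - z‖)
    ⟨by positivity, (div_le_one h).2 ht⟩
  convert this using 1
  rw [unitDir, smul_smul, ← neg_sub x z, smul_neg, sub_eq_add_neg, div_eq_mul_inv]

/-- If a 1-Lipschitz function drops by the full distance between `x` and `z`, it is affine with slope
one on the segment `[x, z]`. -/
theorem LipschitzWith.apply_sub_smul_unitDir {u : E → ℝ} (hu : LipschitzWith 1 u) {x z : E}
    (hxz : u x - u z = ‖x - z‖) {t : ℝ} (ht0 : 0 ≤ t) (ht : t ≤ ‖x - z‖) :
    u (x - t • unitDir x z) = u x - t := by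
  rcases (norm_nonneg (x - z)).eq_or_lt with h | h
  · have : t = 0 := by linarith
    simp [this]
  have h1 := hu.sub_le_norm_sub x (x - t • unitDir x z)
  have h2 := hu.sub_le_norm_sub (x - t • unitDir x z) z
  rw [norm_sub_smul_unitDir_sub h ht] at h2
  rw [sub_sub_cancel, norm_smul, norm_unitDir h, mul_one, Real.norm_eq_abs, abs_of_nonneg ht0] at h1
  linarith

end Moving

/-- Lipschitz images of Lebesgue null sets are null; no measurability of the set is needed. -/
theorem LipschitzOnWith.volume_image_eq_zero {d : ℕ} {K : NNReal} {f : Euc d → Euc d}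
    {s : Set (Euc d)} (hf : LipschitzOnWith K f s) (hs : volume s = 0) : volume (f '' s) = 0 := by
  have h1 : Measure.hausdorffMeasure (Module.finrank ℝ (Euc d)) s = 0 :=
    Measure.absolutelyContinuous_isAddHaarMeasure _ _ hs
  refine Measure.absolutelyContinuous_isAddHaarMeasure _
    (Measure.hausdorffMeasure (Module.finrank ℝ (Euc d))) ?_
  have := hf.hausdorffMeasure_image_le (d := Module.finrank ℝ (Euc d)) (by positivity)
  rw [h1, mul_zero] at this
  exact le_antisymm this zero_le

theorem aemeasurable_sub_smul_unitDir {d : ℕ} {μ : Measure (Euc d)} {T : Euc d → Euc d}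
    (hT : AEMeasurable T μ) (t : ℝ) : AEMeasurable (fun x => x - t • unitDir x (T x)) μ := by
  have h := (aemeasurable_id (μ := μ)).sub hT
  exact aemeasurable_id.sub ((h.norm.inv.smul h).const_smul t)

/-- Moving by `t` towards the target keeps `μ` absolutely continuous, as long as almost every transport
segment has length at least `l > t`. After the move a point is interior to its segment, with room
`δ = min t (l - t)` on both sides, so the inverse motion `y ↦ y + t p(y)` is Lipschitz and maps null
sets to null sets. -/
theorem map_sub_smul_unitDir_absolutelyContinuous {d : ℕ} {μ : Measure (Euc d)}
    (hac : μ ≪ volume) {T : Euc d → Euc d} (hT : AEMeasurable T μ) {u : Euc d → ℝ}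
    (hu : LipschitzWith 1 u) (hslope : ∀ᵐ x ∂μ, u x - u (T x) = ‖x - T x‖) {t l : ℝ}
    (ht : 0 ≤ t) (htl : t < l) (hl : ∀ᵐ x ∂μ, l ≤ ‖x - T x‖) :
    μ.map (fun x => x - t • unitDir x (T x)) ≪ volume := by
  classical
  rcases ht.eq_or_lt with rfl | ht
  · simpa using hac
  have hX := aemeasurable_sub_smul_unitDir hT t
  obtain ⟨δ, hδ, hδt, hδl⟩ : ∃ δ : ℝ, 0 < δ ∧ δ ≤ t ∧ δ ≤ l - t :=
    ⟨min t (l - t), lt_min ht (by linarith), min_le_left _ _, min_le_right _ _⟩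
  let B : Set (Euc d) := {y | ∃ p, IsRayDirection u δ y p}
  let p : Euc d → Euc d := fun y => if h : ∃ p, IsRayDirection u δ y p then h.choose else 0
  have hp : ∀ y ∈ B, IsRayDirection u δ y (p y) := fun y hy => by
    have hy' : ∃ p, IsRayDirection u δ y p := hy
    simp only [p, dif_pos hy']
    exact hy'.choose_spec
  have hpL : LipschitzOnWith (3 / δ).toNNReal p B := by
    refine LipschitzOnWith.of_dist_le_mul fun y hy y' hy' => ?_
    rw [Real.coe_toNNReal _ (by positivity), dist_eq_norm, dist_eq_norm]
    exact (hp y hy).norm_sub_le hu hδ (hp y' hy')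
  have hgL : LipschitzOnWith (1 + ‖t‖₊ * (3 / δ).toNNReal) (fun y => y + t • p y) B :=
    LipschitzOnWith.add LipschitzWith.id.lipschitzOnWith
      ((lipschitzWith_smul t).comp_lipschitzOnWith hpL)
  refine Measure.AbsolutelyContinuous.mk fun N hN hN0 => ?_
  rw [Measure.map_apply_of_aemeasurable hX hN]
  have hnull : volume ((fun y => y + t • p y) '' (N ∩ B)) = 0 :=
    (hgL.mono Set.inter_subset_right).volume_image_eq_zero
      (measure_mono_null Set.inter_subset_left hN0)
  refine measure_mono_null_ae ?_ (hac hnull)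
  filter_upwards [hslope, hl] with x hx hlx hxN
  have hpos : 0 < ‖x - T x‖ := by linarith
  have hdir : IsRayDirection u δ (x - t • unitDir x (T x)) (unitDir x (T x)) := by
    refine ⟨norm_unitDir hpos, ?_, ?_⟩
    · rw [show x - t • unitDir x (T x) + δ • unitDir x (T x) =
          x - (t - δ) • unitDir x (T x) by rw [sub_smul]; abel,
        hu.apply_sub_smul_unitDir hx (by linarith) (by linarith),
        hu.apply_sub_smul_unitDir hx (by linarith) (by linarith)]
      ring
    · rw [sub_sub, ← add_smul, hu.apply_sub_smul_unitDir hx (by linarith) (by linarith),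
        hu.apply_sub_smul_unitDir hx (by linarith) (by linarith)]
      ring
  refine ⟨x - t • unitDir x (T x), ⟨hxN, _, hdir⟩, ?_⟩
  have h1 := (hp _ ⟨_, hdir⟩).norm_sub_le hu hδ hdir
  rw [sub_self, norm_zero, mul_zero] at h1
  have h2 := sub_eq_zero.1 (norm_le_zero_iff.1 h1)
  simp only
  rw [h2, sub_add_cancel]

open scoped InnerProductSpace Gradient in
/-- Where a 1-Lipschitz function is differentiable and decreases with slope one towards `z`, its gradient
is the unit vector pointing away from `z`. -/
theorem gradient_eq_unitDir {E : Type*} [NormedAddCommGroup E] [InnerProductSpace ℝ E]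
    [CompleteSpace E] {w : E → ℝ} (hw : LipschitzWith 1 w) {y z : E}
    (hd : DifferentiableAt ℝ w y) (hyz : w y - w z = ‖y - z‖) (hpos : 0 < ‖y - z‖) :
    ∇ w y = unitDir y z := by
  have h1 : ‖∇ w y‖ ≤ 1 := by
    rw [gradient, LinearIsometryEquiv.norm_map]
    simpa using norm_fderiv_le_of_lipschitz ℝ hw
  -- `w` has derivative `-1` along the segment towards `z`, and a vector of norm at most one whose
  -- inner product with a unit vector is one equals that vector
  have h2 : ⟪∇ w y, unitDir y z⟫_ℝ = 1 := by
    have hf : HasDerivAt (fun s : ℝ => y - s • unitDir y z) (-unitDir y z) 0 := by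
      simpa using ((hasDerivAt_id (0 : ℝ)).smul_const (unitDir y z)).const_sub y
    have hc : HasDerivAt (fun s : ℝ => w (y - s • unitDir y z))
        (fderiv ℝ w y (-unitDir y z)) 0 := by
      have hd' : HasFDerivAt w (fderiv ℝ w y) (y - (0 : ℝ) • unitDir y z) := by
        simpa using hd.hasFDerivAt
      exact hd'.comp_hasDerivAt 0 hf
    have hc' : HasDerivWithinAt (fun s : ℝ => w (y - s • unitDir y z)) (-1)
        (Set.Icc 0 ‖y - z‖) 0 := by
      have : HasDerivWithinAt (fun s : ℝ => w y - s) (-1) (Set.Icc 0 ‖y - z‖) 0 :=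
        ((hasDerivAt_id (0 : ℝ)).const_sub (w y)).hasDerivWithinAt
      exact this.congr (fun s hs => hw.apply_sub_smul_unitDir hyz hs.1 hs.2) (by simp)
    have h3 := (uniqueDiffOn_Icc hpos 0 ⟨le_rfl, hpos.le⟩).eq_deriv _ hc.hasDerivWithinAt hc'
    rw [map_neg, neg_inj] at h3
    rw [gradient, InnerProductSpace.toDual_symm_apply, h3]
  have h4 := norm_sub_sq_real (∇ w y) (unitDir y z)
  rw [h2, norm_unitDir hpos] at h4
  have h5 : ‖∇ w y - unitDir y z‖ ^ 2 ≤ 0 := by nlinarith [norm_nonneg (∇ w y)]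
  exact sub_eq_zero.1 (norm_eq_zero.1 
    (pow_eq_zero_iff two_ne_zero |>.1 (le_antisymm h5 (sq_nonneg _))))

open scoped Gradient in
/-- For an absolutely continuous `m`, the gradient relative to `Ω` is almost everywhere the full gradient
of a Lipschitz extension `w`: the boundary of a convex set is null, and Rademacher's theorem applies. -/
theorem ae_gradStep_eq {d : ℕ} {Ω : Set (Euc d)} (hΩ : IsCompact Ω) (hΩc : Convex ℝ Ω)
    {m : Measure (Euc d)}
    (hm : IsProbOn Ω m) (hac : m ≪ volume) {v w : Euc d → ℝ} (hw : LipschitzWith 1 w)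
    (hvw : Set.EqOn v w Ω) (η : ℝ) :
    ∀ᵐ y ∂m, DifferentiableAt ℝ w y ∧ gradStep Ω η v y = y - η • ∇ w y := by
  have hfr : ∀ᵐ y ∂m, y ∉ frontier Ω :=
    measure_eq_zero_iff_ae_notMem.1 (hac (hΩc.addHaar_frontier volume))
  filter_upwards [hm.ae_mem, hfr, hac.ae_le hw.ae_differentiableAt] with y hy hyf hd
  have hint : y ∈ interior Ω := by
    rw [hΩ.isClosed.frontier_eq] at hyf
    by_contra h
    exact hyf ⟨hy, h⟩
  have hn : Ω ∈ nhds y := mem_interior_iff_mem_nhds.1 hint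
  have hdv : DifferentiableWithinAt ℝ v Ω y :=
    hd.differentiableWithinAt.congr (fun x hx => hvw hx) (hvw hy)
  refine ⟨hd, ?_⟩
  rw [gradStep, if_pos hdv, gradientWithin, gradient, fderivWithin_congr hvw (hvw hy),
    fderivWithin_of_mem_nhds hn]

open scoped Gradient in
theorem aemeasurable_gradStep {d : ℕ} {Ω : Set (Euc d)} (hΩ : IsCompact Ω) (hΩc : Convex ℝ Ω)
    {m : Measure (Euc d)}
    (hm : IsProbOn Ω m) (hac : m ≪ volume) {v w : Euc d → ℝ} (hw : LipschitzWith 1 w)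
    (hvw : Set.EqOn v w Ω) (η : ℝ) : AEMeasurable (gradStep Ω η v) m := by
  have hg : Measurable (∇ w) :=
    (InnerProductSpace.toDual ℝ (Euc d)).symm.continuous.measurable.comp (measurable_fderiv ℝ w)
  refine (measurable_id.sub (hg.const_smul η)).aemeasurable.congr ?_
  filter_upwards [ae_gradStep_eq hΩ hΩc hm hac hw hvw η] with y hy using hy.2.symm

/-! ### The horizon, and the displacement of `μ` along the transport segments -/

section Horizon

variable {θ l W : ℝ} {n : ℕ}

/-- Up to the horizon, the total distance `W (1 - (1 - θ)ⁿ)` covered in `n` steps stays strictly below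
the minimal transport length `l`. -/
theorem mul_one_sub_pow_lt_of_le_horizon (hθ : θ ∈ Set.Ioo (0 : ℝ) 1) (hW : 0 < W)
    (hn : ((n : ℤ) : WithTop ℤ) ≤ horizon θ l W) : W * (1 - (1 - θ) ^ n) < l := by
  have h0 : 0 < 1 - θ := by linarith [hθ.2]
  unfold horizon at hn
  split_ifs at hn with h
  · have hx : 0 < 1 - l / W := by rw [sub_pos, div_lt_one hW]; exact h
    have h1 : (n : ℤ) < ⌈Real.logb (1 - θ) (1 - l / W)⌉ := by
      have := WithTop.coe_le_coe.1 hn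
      omega
    have h2 := Int.lt_ceil.1 h1
    rw [Real.lt_logb_iff_rpow_lt_of_base_lt_one h0 (by linarith [hθ.1]) hx] at h2
    simp only [Int.cast_natCast, Real.rpow_natCast] at h2
    have h3 := mul_lt_mul_of_pos_left h2 hW
    have h4 : W * (1 - l / W) = W - l := by field_simp
    linarith
  · have := mul_pos hW (pow_pos h0 n)
    linarith

theorem pow_succ_le_of_eq_horizon (hθ : θ ∈ Set.Ioo (0 : ℝ) 1) (hW : 0 < W) (hl : l < W)
    (hn : ((n : ℤ) : WithTop ℤ) = horizon θ l W) : (1 - θ) ^ (n + 1) ≤ 1 - l / W := by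
  have h0 : 0 < 1 - θ := by linarith [hθ.2]
  rw [horizon, if_pos hl] at hn
  have hx : 0 < 1 - l / W := by rw [sub_pos, div_lt_one hW]; exact hl
  have h1 : ⌈Real.logb (1 - θ) (1 - l / W)⌉ ≤ ((n + 1 : ℕ) : ℤ) := by
    have := WithTop.coe_injective hn
    push_cast
    omega
  have h2 := Int.ceil_le.1 h1
  rw [Real.logb_le_iff_le_rpow_of_base_lt_one h0 (by linarith [hθ.1]) hx] at h2
  rwa [Int.cast_natCast, Real.rpow_natCast] at h2

end Horizon

theorem exists_ae_le_of_lt_minLength {d : ℕ} {Ω : Set (Euc d)} {μ : Measure (Euc d)}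
    (hμ : IsProbOn Ω μ) {T : Euc d → Euc d} {t : ℝ} (ht : t < minLength Ω μ T) :
    ∃ l, t < l ∧ ∀ᵐ x ∂μ, l ≤ ‖x - T x‖ := by
  have hne : {l : ℝ | μ {x ∈ Ω | ‖x - T x‖ < l} = 0}.Nonempty :=
    ⟨0, by simp [(norm_nonneg _).not_gt]⟩
  obtain ⟨l, hl, htl⟩ := exists_lt_of_lt_csSup hne ht
  refine ⟨l, htl, ?_⟩
  filter_upwards [hμ.ae_mem, measure_eq_zero_iff_ae_notMem.1 hl] with x hx hxl
  exact not_lt.1 fun h => hxl ⟨hx, h⟩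

theorem gradStep_zero {d : ℕ} (Ω : Set (Euc d)) (u : Euc d → ℝ) : gradStep Ω 0 u = id := by
  funext x
  simp [gradStep]

section ZeroCost

variable {d : ℕ} {Ω : Set (Euc d)} {μ ν : Measure (Euc d)} {T : Euc d → Euc d}

theorem IsTransportMap.map_prodMk_mem (hT : IsTransportMap Ω μ ν T) :
    μ.map (fun x => (x, T x)) ∈ transportPlans μ ν := by
  have hXY := (aemeasurable_id (μ := μ)).prodMk hT.1
  constructor
  · exact (AEMeasurable.map_map_of_aemeasurable measurable_fst.aemeasurable hXY).trans
      Measure.map_id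
  · exact (AEMeasurable.map_map_of_aemeasurable measurable_snd.aemeasurable hXY).trans hT.2.2

/-- The value of the Kantorovich problem is finite, so that the `toReal` in `W1` loses nothing. -/
theorem IsTransportMap.iInf_ne_top (hΩ : IsCompact Ω) (hμ : IsProbOn Ω μ)
    (hT : IsTransportMap Ω μ ν T) :
    (⨅ γ ∈ transportPlans μ ν, ∫⁻ p, ‖p.1 - p.2‖ₑ ∂γ) ≠ ∞ := by
  have := hμ.1
  refine ne_top_of_le_ne_top ?_ (iInf₂_le _ hT.map_prodMk_mem)
  rw [lintegral_map' (by fun_prop) (aemeasurable_id'.prodMk hT.1)]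
  have h1 : Integrable (fun x => ‖x - T x‖) μ :=
    integrable_norm_sub_of_ae_mem hΩ aemeasurable_id hT.1 hμ.ae_mem (hT.ae_mem hμ)
  have := h1.2.ne
  simpa [HasFiniteIntegral] using this

/-- If `W1 μ ν = 0`, weak duality makes the zero function a potential. -/
theorem isKantorovichPotential_of_W1_eq_zero (hΩ : IsCompact Ω) (hμ : IsProbOn Ω μ)
    (hν : IsProbOn Ω ν) (hT : IsTransportMap Ω μ ν T) (hW : W1 μ ν = 0) :
    IsKantorovichPotential Ω μ ν 0 := by
  refine ⟨(LipschitzWith.const 0).weaken zero_le |>.lipschitzOnWith, fun v hv => ?_⟩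
  obtain ⟨w, hw, hvw⟩ := hv.extend_real
  rw [setIntegral_congr_fun hΩ.measurableSet hvw, setIntegral_congr_fun hΩ.measurableSet hvw,
    hμ.restrict_eq, hν.restrict_eq]
  have h0 := ((ENNReal.toReal_eq_zero_iff _).1 hW).resolve_right (hT.iInf_ne_top hΩ hμ)
  have h1 : ENNReal.ofReal ((∫ x, w x ∂μ) - ∫ x, w x ∂ν) ≤ 0 := by
    rw [← h0]
    exact le_iInf₂ fun γ hγ => integral_sub_le_integral_norm hΩ hμ hν hγ hw
  have h2 := ENNReal.ofReal_eq_zero.1 (le_antisymm h1 zero_le)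
  simpa using h2

theorem IsTTCRun.eq_of_W1_eq_zero {θ : ℝ} {K : ℕ} {μs : ℕ → Measure (Euc d)}
    {us : ℕ → Euc d → ℝ} (hW : W1 μ ν = 0) (h : IsTTCRun Ω θ μ ν K μs us) :
    ∀ n ≤ K, μs n = μ := by
  intro n
  induction n with
  | zero => exact fun _ => h.1
  | succ n ih =>
    intro hn
    rw [(h.2 n hn).2, ih (by omega), hW, mul_zero, gradStep_zero, Measure.map_id]

/-- In dimension zero all distances vanish. The case has to be excluded because Lebesgue measure on a
point is a Dirac mass, hence not atomless. -/
theorem IsTransportMap.dim_ne_zero (hT : IsTransportMap Ω μ ν T) (hW : W1 μ ν ≠ 0) :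
    d ≠ 0 := by
  rintro rfl
  refine hW ((ENNReal.toReal_eq_zero_iff _).2 (.inl (le_antisymm ?_ zero_le)))
  refine (iInf₂_le _ hT.map_prodMk_mem).trans_eq ?_
  refine (lintegral_congr fun p => ?_).trans lintegral_zero
  rw [Subsingleton.elim p.1 p.2, sub_self, enorm_zero]

end ZeroCost

section Displacement

variable {d : ℕ} {Ω : Set (Euc d)} {μ ν : Measure (Euc d)} {T : Euc d → Euc d} {u : Euc d → ℝ}
  {t l : ℝ}

theorem isProbOn_map_sub_smul_unitDir (hΩ : IsCompact Ω) (hΩc : Convex ℝ Ω) (hμ : IsProbOn Ω μ)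
    (hT : IsTransportMap Ω μ ν T) (ht : 0 ≤ t) (htl : t < l) (hl : ∀ᵐ x ∂μ, l ≤ ‖x - T x‖) :
    IsProbOn Ω (μ.map fun x => x - t • unitDir x (T x)) := by
  have := hμ.1
  have hX := aemeasurable_sub_smul_unitDir hT.1 t
  refine ⟨Measure.isProbabilityMeasure_map hX, ?_⟩
  rw [Measure.map_apply_of_aemeasurable hX hΩ.measurableSet.compl]
  refine measure_eq_zero_iff_ae_notMem.2 ?_
  filter_upwards [hμ.ae_mem, hl] with x hx hlx
  exact not_not.2 (sub_smul_unitDir_mem hΩc hx (hT.2.1 hx) (by linarith) ht (by linarith))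

theorem ae_slope_sub_smul_unitDir (hu : LipschitzWith 1 u)
    (hslope : ∀ᵐ x ∂μ, u x - u (T x) = ‖x - T x‖) (ht : 0 ≤ t) (htl : t < l)
    (hl : ∀ᵐ x ∂μ, l ≤ ‖x - T x‖) :
    ∀ᵐ x ∂μ, u (x - t • unitDir x (T x)) - u (T x) = ‖x - t • unitDir x (T x) - T x‖ := by
  filter_upwards [hslope, hl] with x hx hlx
  rw [norm_sub_smul_unitDir_sub (by linarith) (by linarith),
    hu.apply_sub_smul_unitDir hx ht (by linarith)]
  linarith

/-- Moving all the mass by `t` along the transport segments lowers the distance to `ν` by exactly `t`. -/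
theorem W1_map_sub_smul_unitDir (hΩ : IsCompact Ω) (hΩc : Convex ℝ Ω) (hμ : IsProbOn Ω μ)
    (hν : IsProbOn Ω ν) (hT : IsTransportMap Ω μ ν T) (hu : LipschitzWith 1 u)
    (hslope : ∀ᵐ x ∂μ, u x - u (T x) = ‖x - T x‖) (ht : 0 ≤ t) (htl : t < l)
    (hl : ∀ᵐ x ∂μ, l ≤ ‖x - T x‖) :
    W1 (μ.map fun x => x - t • unitDir x (T x)) ν = W1 μ ν - t := by
  have := hμ.1
  have hXt := aemeasurable_sub_smul_unitDir hT.1 t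
  have hP := isProbOn_map_sub_smul_unitDir hΩ hΩc hμ hT ht htl hl
  have hν' : IsProbOn Ω (μ.map T) := hT.2.2.symm ▸ hν
  have h1 : W1 μ ν = ∫ x, ‖x - T x‖ ∂μ := by
    have := W1_eq_integral_of_slope (X := id) hΩ aemeasurable_id hT.1 (by rwa [Measure.map_id])
      hν' hu hslope
    rwa [Measure.map_id, hT.2.2] at this
  have h2 := W1_eq_integral_of_slope hΩ hXt hT.1 hP hν' hu
    (ae_slope_sub_smul_unitDir hu hslope ht htl hl)
  rw [hT.2.2] at h2
  have h3 : ∫ x, ‖x - t • unitDir x (T x) - T x‖ ∂μ = ∫ x, (‖x - T x‖ - t) ∂μ :=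
    integral_congr_ae (by
      filter_upwards [hl] with x hlx
      exact norm_sub_smul_unitDir_sub (by linarith) (by linarith))
  have h4 : Integrable (fun x => ‖x - T x‖) μ :=
    integrable_norm_sub_of_ae_mem hΩ aemeasurable_id hT.1 hμ.ae_mem (hT.ae_mem hμ)
  rw [h2, h3, integral_sub h4 (integrable_const t), h1]
  simp

theorem isKantorovichPotential_map_sub_smul_unitDir (hΩ : IsCompact Ω) (hΩc : Convex ℝ Ω)
    (hμ : IsProbOn Ω μ) (hν : IsProbOn Ω ν) (hT : IsTransportMap Ω μ ν T)
    (hu : LipschitzWith 1 u) (hslope : ∀ᵐ x ∂μ, u x - u (T x) = ‖x - T x‖) (ht : 0 ≤ t)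
    (htl : t < l) (hl : ∀ᵐ x ∂μ, l ≤ ‖x - T x‖) :
    IsKantorovichPotential Ω (μ.map fun x => x - t • unitDir x (T x)) ν u := by
  have := hμ.1
  have h := isKantorovichPotential_of_slope hΩ (aemeasurable_sub_smul_unitDir hT.1 t) hT.1
    (isProbOn_map_sub_smul_unitDir hΩ hΩc hμ hT ht htl hl) (hT.2.2.symm ▸ hν) hu
    (ae_slope_sub_smul_unitDir hu hslope ht htl hl)
  rwa [hT.2.2] at h

/-- A gradient step of length `η`, for any potential `v` of the displaced measure and `ν`, prolongs the
displacement from `t` to `t + η`. -/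
theorem map_gradStep_map_sub_smul_unitDir (hΩ : IsCompact Ω) (hΩc : Convex ℝ Ω)
    (hμ : IsProbOn Ω μ) (hν : IsProbOn Ω ν) (hac : μ ≪ volume) (hT : IsTransportMap Ω μ ν T)
    (hu : LipschitzWith 1 u) (hslope : ∀ᵐ x ∂μ, u x - u (T x) = ‖x - T x‖) (ht : 0 ≤ t)
    (htl : t < l) (hl : ∀ᵐ x ∂μ, l ≤ ‖x - T x‖) {v : Euc d → ℝ}
    (hv : IsKantorovichPotential Ω (μ.map fun x => x - t • unitDir x (T x)) ν v) (η : ℝ) :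
    (μ.map fun x => x - t • unitDir x (T x)).map (gradStep Ω η v) =
      μ.map fun x => x - (t + η) • unitDir x (T x) := by
  have := hμ.1
  obtain ⟨w, hw, hvw⟩ := hv.1.extend_real
  have hX := aemeasurable_sub_smul_unitDir hT.1 t
  have hP := isProbOn_map_sub_smul_unitDir hΩ hΩc hμ hT ht htl hl
  have hac' := map_sub_smul_unitDir_absolutelyContinuous hac hT.1 hu hslope ht htl hl
  have hν' : IsProbOn Ω (μ.map T) := hT.2.2.symm ▸ hν
  have hwslope := IsKantorovichPotential.slope hΩ hX hT.1 hP hν' hu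
    (ae_slope_sub_smul_unitDir hu hslope ht htl hl) (hT.2.2.symm ▸ hv) hw hvw
  rw [AEMeasurable.map_map_of_aemeasurable (aemeasurable_gradStep hΩ hΩc hP hac' hw hvw η) hX]
  refine Measure.map_congr ?_
  filter_upwards [hwslope, hl, ae_of_ae_map hX (ae_gradStep_eq hΩ hΩc hP hac' hw hvw η)]
    with x hx hlx hg
  have hpos : 0 < ‖x - T x‖ := by linarith
  have hpos' : 0 < ‖x - t • unitDir x (T x) - T x‖ := by
    rw [norm_sub_smul_unitDir_sub hpos (by linarith)]; linarith
  rw [Function.comp_apply, hg.2, gradient_eq_unitDir hw hg.1 hx hpos',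
    unitDir_sub_smul hpos (by linarith), add_smul, sub_sub]

end Displacement

theorem theorem2 (d : ℕ) (Ω : Set (Euc d)) (hΩ : IsCompact Ω) (hΩc : Convex ℝ Ω)
    (μ ν : Measure (Euc d)) (hμ : IsProbOn Ω μ) (hν : IsProbOn Ω ν) (hac : μ ≪ volume)
    (θ : ℝ) (hθ : θ ∈ Set.Ioo (0 : ℝ) 1)
    (T₀ : Euc d → Euc d) (hT₀ : IsOptimalMap Ω μ ν T₀) :
    -- TTC can be run up to every index that does not exceed `N(θ)`
    (∀ K : ℕ, ((K : ℤ) : WithTop ℤ) ≤ horizon θ (minLength Ω μ T₀) (W1 μ ν) →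
      ∃ (μs : ℕ → Measure (Euc d)) (us : ℕ → Euc d → ℝ), IsTTCRun Ω θ μ ν K μs us) ∧
    -- whatever potentials are chosen in the run
    (∀ (K : ℕ) (μs : ℕ → Measure (Euc d)) (us : ℕ → Euc d → ℝ), IsTTCRun Ω θ μ ν K μs us →
      (∀ n ≤ K, ((n : ℤ) : WithTop ℤ) ≤ horizon θ (minLength Ω μ T₀) (W1 μ ν) →
        IsProbOn Ω (μs n) ∧ W1 (μs n) ν = (1 - θ) ^ n * W1 μ ν) ∧
      (minLength Ω μ T₀ < W1 μ ν →
        ∀ n ≤ K, ((n : ℤ) : WithTop ℤ) = horizon θ (minLength Ω μ T₀) (W1 μ ν) →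
          W1 (μs n) ν ≤ (W1 μ ν - minLength Ω μ T₀) / (1 - θ))) := by
  have hθ0 : 0 < 1 - θ := by linarith [hθ.2]
  have hW0 : 0 ≤ W1 μ ν := ENNReal.toReal_nonneg
  rcases hW0.eq_or_lt' with hW | hW
  · -- for `W₁(μ, ν) = 0` all steps have length zero
    refine ⟨fun K _ => ⟨fun _ => μ, fun _ => 0, rfl, fun n _ =>
      ⟨isKantorovichPotential_of_W1_eq_zero hΩ hμ hν hT₀.1 hW, by
        rw [hW, mul_zero, gradStep_zero, Measure.map_id]⟩⟩, fun K μs us hrun => ⟨?_, ?_⟩⟩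
    · intro n hn _
      rw [hrun.eq_of_W1_eq_zero hW n hn, hW, mul_zero]
      exact ⟨hμ, rfl⟩
    · intro hl n hn _
      rw [hrun.eq_of_W1_eq_zero hW n hn]
      rw [hW] at hl ⊢
      exact div_nonneg (by linarith) hθ0.le
  have hd : Nonempty (Fin d) := Fin.pos_iff_nonempty.1
    (Nat.pos_of_ne_zero (hT₀.1.dim_ne_zero hW.ne'))
  have hna : NullSingletonClass μ := ⟨fun x => hac (measure_singleton x)⟩
  obtain ⟨u, hu, hslope⟩ := hT₀.exists_lipschitz_sub_eq_norm hΩ hμ hν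
  set W := W1 μ ν with hWdef
  -- the distance covered by the first `n` steps
  let t : ℕ → ℝ := fun n => W * (1 - (1 - θ) ^ n)
  have ht0 : ∀ n, 0 ≤ t n := fun n =>
    mul_nonneg hW.le (sub_nonneg.2 (pow_le_one₀ hθ0.le (by linarith [hθ.1])))
  have hex : ∀ n : ℕ, ((n : ℤ) : WithTop ℤ) ≤ horizon θ (minLength Ω μ T₀) W →
      ∃ l, t n < l ∧ ∀ᵐ x ∂μ, l ≤ ‖x - T₀ x‖ := fun n hn =>
    exists_ae_le_of_lt_minLength hμ (mul_one_sub_pow_lt_of_le_horizon hθ hW hn)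
  let m : ℕ → Measure (Euc d) := fun n => μ.map fun x => x - t n • unitDir x (T₀ x)
  have hm0 : m 0 = μ := by simp [m, t]
  have hW1 : ∀ n : ℕ, ((n : ℤ) : WithTop ℤ) ≤ horizon θ (minLength Ω μ T₀) W →
      W1 (m n) ν = (1 - θ) ^ n * W := fun n hn => by
    obtain ⟨l, htl, hl⟩ := hex n hn
    rw [W1_map_sub_smul_unitDir hΩ hΩc hμ hν hT₀.1 hu hslope (ht0 n) htl hl, ← hWdef]
    simp only [t]
    ring
  have hstep : ∀ n : ℕ, ((n : ℤ) : WithTop ℤ) ≤ horizon θ (minLength Ω μ T₀) W →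
      ∀ v, IsKantorovichPotential Ω (m n) ν v →
      m (n + 1) = (m n).map (gradStep Ω (θ * W1 (m n) ν) v) := fun n hn v hv => by
    obtain ⟨l, htl, hl⟩ := hex n hn
    have h1 := map_gradStep_map_sub_smul_unitDir hΩ hΩc hμ hν hac hT₀.1 hu hslope (ht0 n) htl hl hv
      (θ * W1 (m n) ν)
    rw [h1, hW1 n hn, show t n + θ * ((1 - θ) ^ n * W) = t (n + 1) by simp only [t]; ring]
  have hmono : ∀ n k : ℕ, n ≤ k → ((k : ℤ) : WithTop ℤ) ≤ horizon θ (minLength Ω μ T₀) W →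
      ((n : ℤ) : WithTop ℤ) ≤ horizon θ (minLength Ω μ T₀) W := fun n k hnk hk =>
    le_trans (WithTop.coe_le_coe.2 (by exact_mod_cast hnk)) hk
  refine ⟨fun K hK => ⟨m, fun _ => u, hm0, fun n hn => ?_⟩, fun K μs us hrun => ?_⟩
  · have hn' := hmono n K hn.le hK
    obtain ⟨l, htl, hl⟩ := hex n hn'
    have hpot : IsKantorovichPotential Ω (m n) ν u :=
      isKantorovichPotential_map_sub_smul_unitDir hΩ hΩc hμ hν hT₀.1 hu hslope (ht0 n) htl hl
    exact ⟨hpot, hstep n hn' u hpot⟩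
  have hμs : ∀ n ≤ K, ((n : ℤ) : WithTop ℤ) ≤ horizon θ (minLength Ω μ T₀) W → μs n = m n := by
    intro n
    induction n with
    | zero => intro _ _; rw [hm0, hrun.1]
    | succ n ih =>
      intro hnK hn
      have hn' := hmono n (n + 1) n.le_succ hn
      obtain ⟨hpot, heq⟩ := hrun.2 n hnK
      rw [ih (by omega) hn'] at hpot heq
      rw [heq, hstep n hn' _ hpot]
  have hmain : ∀ n ≤ K, ((n : ℤ) : WithTop ℤ) ≤ horizon θ (minLength Ω μ T₀) W →
      IsProbOn Ω (μs n) ∧ W1 (μs n) ν = (1 - θ) ^ n * W := fun n hnK hn => by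
    obtain ⟨l, htl, hl⟩ := hex n hn
    rw [hμs n hnK hn]
    exact ⟨isProbOn_map_sub_smul_unitDir hΩ hΩc hμ hT₀.1 (ht0 n) htl hl, hW1 n hn⟩
  refine ⟨hmain, fun hl n hnK hn => ?_⟩
  rw [(hmain n hnK hn.le).2, le_div_iff₀ hθ0]
  have h1 := mul_le_mul_of_nonneg_left (pow_succ_le_of_eq_horizon hθ hW hl hn) hW.le
  have h2 : W * (1 - minLength Ω μ T₀ / W) = W - minLength Ω μ T₀ := by field_simp
  rw [h2] at h1
  calc (1 - θ) ^ n * W * (1 - θ) = W * (1 - θ) ^ (n + 1) := by ring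
    _ ≤ _ := h1
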